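/- Let $d\ge 0$ and let $\mathbb R^{d,2}$ be $\mathbb R^{d+2}$ with the bilinear form $\langle x,y\rangle=x_1y_1+\dots+x_dy_d-x_{d+1}y_{d+1}-x_{d+2}y_{d+2}$ and $\mathbf q(x)=\langle x,x\rangle$. Put $\mathrm{AdS}^{d+1}=\{x:\mathbf q(x)=-1\}$ and $\mathrm{Ein}^d=\{x\neq 0:\mathbf q(x)=0\}/\mathbb R_{>0}$, both viewed inside the sphere of rays $\mathrm S^{d+1}=(\mathbb R^{d,2}\setminus\{0\})/\mathbb R_{>0}$. A spacelike geodesic of $\mathrm{AdS}^{d+1}$ is a connected component of $P\cap \mathrm{AdS}^{d+1}$, where $P$ is a $2$-plane on which $\mathbf q$ has signature $(1,1)$. Two points of $\mathrm{AdS}^{d+1}$ are space related if they lie on a common spacelike geodesic. Two points of $\mathrm{Ein}^d$ are space related if they are the endpoints in $\mathrm S^{d+1}$ of a spacelike geodesic, and light related if they lie on a common photon (the projectivisation of a totally isotropic $2$-plane). A subset of $\mathrm{Ein}^d$ is achronal if any two distinct points of it are space or light related. Let $\mathcal H$ be a connected Lipschitz manifold of dimension $d$ with a Lipschitz distance $d_{\mathcal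 H}$, i.e. a distance inducing the topology of $\mathcal H$ that is locally bi-Lipschitz to the Euclidean distance in charts. A map $i:\mathcal H\to\mathrm{AdS}^{d+1}$ is a spacelike immersion if it is locally Lipschitz and every point of $\mathcal H$ has a neighbourhood $U$ and a constant $c>0$ with $\langle i(p),i(p')\rangle\le -1-c\,d_{\mathcal H}(p,p')^2$ for all $p,p'\in U$. It is complete if every Cauchy sequence for the distance $$i^*d_{\mathrm{AdS}}(x,y)=\inf_\gamma\int_0^1\sqrt{\mathbf q\big((i\circ\gamma)'(t)\big)}\,\mathrm dt$$ converges for it, where $\gamma$ runs over the Lipschitz paths $[0,1]\to\mathcal H$ from $x$ to $y$. **Proposition.** Let $i:\mathcal H\to\mathrm{AdS}^{d+1}$ be a complete spacelike immersion. Then: 1. $\mathcal H$ is homeomorphic to the open unit ball $\mathrm B^d$ of $\mathbb R^d$; 2. $i$ is an embedding, i.e. a homeomorphism onto its image; 3. $i(x)$ and $i(y)$ are space related for all $x\ne y$ in $\mathcal H$; 4. $i$ extends continuously to an achronal embedding $\partial i:\mathrm S^{d-1}=\partial\mathrm B^d\to\mathrm{Ein}^d$: there are a homeomorphism $h:\mathcal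 H\to\mathrm B^d$, a topological embedding $\partial i:\mathrm S^{d-1}\to\mathrm{Ein}^d$ with achronal image, and a continuous map $F:\overline{\mathrm B^d}\to\mathrm S^{d+1}$ such that $F(h(p))=\mathbb R_{>0}\,i(p)$ for all $p\in\mathcal H$ and $F=\partial i$ on $\mathrm S^{d-1}$. -/

import Mathlib

open Set Metric Topology Filter

namespace AdSGeometry

noncomputable section

/-! ### The space `ℝ^{d,2}` and anti-de Sitter space -/

/-- Euclidean space `ℝ^n`. -/
abbrev E (n : ℕ) : Type := EuclideanSpace ℝ (Fin n)

/-- The vector space `ℝ^{d+2}`, whose first factor holds the coordinates `x_1, …, x_d` and whose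
second factor holds `x_{d+1}, x_{d+2}`. -/
abbrev V (d : ℕ) : Type := E d × E 2

/-- The symmetric bilinear form of signature `(d, 2)`,
`⟨x, y⟩ = x_1 y_1 + ⋯ + x_d y_d - x_{d+1} y_{d+1} - x_{d+2} y_{d+2}`. -/
def form {d : ℕ} (x y : V d) : ℝ :=
  ∑ k : Fin d, x.1 k * y.1 k - ∑ k : Fin 2, x.2 k * y.2 k

/-- The quadratic form `q(x) = ⟨x, x⟩`. -/
def quad {d : ℕ} (x : V d) : ℝ := form x x

/-- Anti-de Sitter space of dimension `d + 1`: the quadric `q = -1` in `ℝ^{d,2}`, with the topology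
and the distance induced by the ambient vector space. -/
def AdS (d : ℕ) : Set (V d) := {x | quad x = -1}

theorem ne_zero_of_mem_AdS {d : ℕ} {x : V d} (hx : x ∈ AdS d) : x ≠ 0 := by
  rintro rfl
  simp [AdS, quad, form] at hx

/-- A spacelike geodesic of `AdS^{d+1}`: a connected component (a branch of hyperbola) of the
intersection of `AdS^{d+1}` with a `2`-plane on which `q` has signature `(1, 1)`. -/
def IsSpacelikeGeodesic {d : ℕ} (G : Set (V d)) : Prop :=
  ∃ P : Submodule ℝ (V d), Module.finrank ℝ P = 2 ∧
    (∃ u ∈ P, 0 < quad u) ∧ (∃ v ∈ P, quad v < 0) ∧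
    ∃ x ∈ (P : Set (V d)) ∩ AdS d, G = connectedComponentIn ((P : Set (V d)) ∩ AdS d) x

/-- Two points of `AdS^{d+1}` are space related if they belong to the same spacelike geodesic. -/
def SpaceRelated {d : ℕ} (x y : AdS d) : Prop :=
  ∃ G : Set (V d), IsSpacelikeGeodesic G ∧ (x : V d) ∈ G ∧ (y : V d) ∈ G

/-! ### The sphere of rays and the Einstein space -/

/-- The sphere `S^{d+1} = (ℝ^{d,2} ∖ {0}) / ℝ_{>0}` of rays. -/
abbrev RaySphere (d : ℕ) : Type := Module.Ray ℝ (V d)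

/-- The quotient topology on the sphere of rays. -/
instance RaySphere.instTopologicalSpace (d : ℕ) : TopologicalSpace (RaySphere d) :=
  TopologicalSpace.coinduced (fun v : {v : V d // v ≠ 0} => rayOfNeZero ℝ v.1 v.2) inferInstance

/-- The inclusion of `AdS^{d+1}` in the sphere of rays, `x ↦ ℝ_{>0} x`. -/
def AdS.toRay {d : ℕ} (x : AdS d) : RaySphere d :=
  rayOfNeZero ℝ (x : V d) (ne_zero_of_mem_AdS x.2)

/-- The rays of the nonzero vectors of a set. -/
def rays {d : ℕ} (S : Set (V d)) : Set (RaySphere d) :=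
  {r | ∃ (v : V d) (hv : v ≠ 0), v ∈ S ∧ r = rayOfNeZero ℝ v hv}

/-- The Einstein space `Ein^d`: the rays of the nonzero isotropic vectors of `ℝ^{d,2}`. -/
def Ein (d : ℕ) : Set (RaySphere d) := rays {v | quad v = 0}

/-- Two points of `Ein^d` are light related if they belong to the same photon, i.e. to the
projectivisation of a totally isotropic `2`-plane. -/
def Ein.LightRelated {d : ℕ} (a b : Ein d) : Prop :=
  ∃ P : Submodule ℝ (V d), Module.finrank ℝ P = 2 ∧ (∀ u ∈ P, ∀ v ∈ P, form u v = 0) ∧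
    (a : RaySphere d) ∈ rays (P : Set (V d)) ∧ (b : RaySphere d) ∈ rays (P : Set (V d))

/-- Two points of `Ein^d` are space related if they are the endpoints of a spacelike geodesic of
`AdS^{d+1}`, i.e. if they are the points that one has to add to close it up in the sphere of
rays. -/
def Ein.SpaceRelated {d : ℕ} (a b : Ein d) : Prop :=
  ∃ G : Set (V d), IsSpacelikeGeodesic G ∧
    closure (rays G) \ rays G = {(a : RaySphere d), (b : RaySphere d)}

/-- A subset of `Ein^d` is achronal if any two (distinct) points of it are space or light
related. -/
def Ein.IsAchronal {d : ℕ} (S : Set (Ein d)) : Prop :=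
  S.Pairwise fun a b => Ein.SpaceRelated a b ∨ Ein.LightRelated a b

/-! ### Lipschitz manifolds -/

/-- The pregroupoid of locally Lipschitz maps between open subsets of `ℝ^d`. -/
def lipschitzPregroupoid (d : ℕ) : Pregroupoid (E d) where
  property f s := LocallyLipschitzOn s f
  comp := by
    intro f g u v hf hg _ _ _ x hx
    obtain ⟨K, t, ht, hK⟩ := hf hx.1
    obtain ⟨L, w, hw, hL⟩ := hg hx.2
    have hc : ContinuousWithinAt f (u ∩ f ⁻¹' v) x :=
      (hf.continuousOn x hx.1).mono inter_subset_left
    have hm : Tendsto f (𝓝[u ∩ f ⁻¹' v] x) (𝓝[v] (f x)) :=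
      tendsto_nhdsWithin_iff.2 ⟨hc, eventually_nhdsWithin_of_forall fun y hy => hy.2⟩
    refine ⟨L * K, t ∩ f ⁻¹' w,
      inter_mem (nhdsWithin_mono x inter_subset_left ht) (hm hw), ?_⟩
    exact hL.comp (hK.mono inter_subset_left) fun y hy => hy.2
  id_mem := LocallyLipschitz.id.locallyLipschitzOn
  locality := by
    intro f u _ h x hx
    obtain ⟨v, hv, hxv, hf⟩ := h x hx
    obtain ⟨K, t, ht, hK⟩ := hf ⟨hx, hxv⟩
    refine ⟨K, t, ?_, hK⟩
    rwa [nhdsWithin_inter_of_mem' (mem_nhdsWithin_of_mem_nhds (hv.mem_nhds hxv))] at ht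
  congr := by
    intro f g u _ h hf x hx
    obtain ⟨K, t, ht, hK⟩ := hf hx
    refine ⟨K, t ∩ u, inter_mem ht self_mem_nhdsWithin, fun a ha b hb => ?_⟩
    rw [h a ha.2, h b hb.2]
    exact hK ha.1 hb.1

/-- The groupoid of locally bi-Lipschitz homeomorphisms between open subsets of `ℝ^d`. A Lipschitz
manifold of dimension `d` is a manifold modelled on `ℝ^d` with changes of charts in it. -/
def lipschitzGroupoid (d : ℕ) : StructureGroupoid (E d) := (lipschitzPregroupoid d).groupoid

/-- The distance of `H` is a Lipschitz distance: in every chart it is locally bi-Lipschitz to the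
Euclidean distance. -/
def IsLipschitzDistance (d : ℕ) (H : Type*) [MetricSpace H] [ChartedSpace (E d) H] : Prop :=
  ∀ e ∈ atlas (E d) H, ∀ p ∈ e.source, ∃ U ∈ 𝓝 p, U ⊆ e.source ∧ ∃ C : ℝ, 0 < C ∧
    ∀ x ∈ U, ∀ y ∈ U, dist x y ≤ C * dist (e x) (e y) ∧ dist (e x) (e y) ≤ C * dist x y

/-! ### Spacelike immersions -/

/-- A map `i : H → AdS^{d+1}` is a spacelike immersion if it is locally Lipschitz and if every
point has a neighbourhood `U` with a constant `c > 0` such that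
`⟨i p, i p'⟩ ≤ -1 - c d_H(p, p')²` for all `p, p' ∈ U`. -/
def IsSpacelikeImmersion {d : ℕ} {H : Type*} [MetricSpace H] (i : H → AdS d) : Prop :=
  LocallyLipschitz i ∧
    ∀ x : H, ∃ U ∈ 𝓝 x, ∃ c : ℝ, 0 < c ∧ ∀ p ∈ U, ∀ p' ∈ U,
      form (i p : V d) (i p' : V d) ≤ -1 - c * dist p p' ^ 2

/-- The length `∫₀¹ √(q((i ∘ γ)'(t))) dt` of the image under `i` of a path `γ : [0, 1] → H` (given
by a map on the real line, of which only the restriction to `[0, 1]` matters). -/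
def pathLength {d : ℕ} {H : Type*} (i : H → AdS d) (γ : ℝ → H) : ℝ :=
  ∫ t in (0 : ℝ)..1, √(quad (deriv (fun s : ℝ => (i (γ s) : V d)) t))

/-- The pulled-back distance `i^*d_AdS(x, y)`: the infimum of the lengths of the images of the
Lipschitz paths from `x` to `y`. -/
def pullbackDist {d : ℕ} {H : Type*} [MetricSpace H] (i : H → AdS d) (x y : H) : ℝ :=
  sInf {L : ℝ | ∃ γ : ℝ → H, (∃ K, LipschitzOnWith K γ (Icc 0 1)) ∧ γ 0 = x ∧ γ 1 = y ∧
    L = pathLength i γ}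

/-- The pulled-back distance is complete: every Cauchy sequence for `i^*d_AdS` converges for
`i^*d_AdS`. -/
def PullbackComplete {d : ℕ} {H : Type*} [MetricSpace H] (i : H → AdS d) : Prop :=
  ∀ u : ℕ → H,
    (∀ ε > 0, ∃ N, ∀ m ≥ N, ∀ n ≥ N, pullbackDist i (u m) (u n) < ε) →
    ∃ p : H, Tendsto (fun n => pullbackDist i (u n) p) atTop (𝓝 0)

/-- A complete spacelike immersion. -/
def IsCompleteSpacelikeImmersion {d : ℕ} {H : Type*} [MetricSpace H] (i : H → AdS d) : Prop :=
  IsSpacelikeImmersion i ∧ PullbackComplete i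

/-- `i : H → AdS^{d+1}` extends continuously to `∂i : S^{d-1} → Ein^d`: after an identification
`h` of `H` with the open unit ball `B^d`, there is a continuous map on the closed ball, with values
in the sphere of rays, that is `i` on the open ball and `∂i` on the boundary sphere. -/
def ExtendsContinuouslyTo {d : ℕ} {H : Type*} [TopologicalSpace H] (i : H → AdS d)
    (h : H ≃ₜ ball (0 : E d) 1) (bi : sphere (0 : E d) 1 → Ein d) : Prop :=
  ∃ F : closedBall (0 : E d) 1 → RaySphere d, Continuous F ∧
    (∀ p : H, F ⟨(h p : E d), ball_subset_closedBall (h p).2⟩ = AdS.toRay (i p)) ∧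
    ∀ z : sphere (0 : E d) 1, F ⟨(z : E d), sphere_subset_closedBall z.2⟩ = (bi z : RaySphere d)

end

end AdSGeometry

/-! ### A degree formula for Lipschitz maps of a ball. -/

section LipschitzDegree

open MeasureTheory

variable {F : Type*} [NormedAddCommGroup F]

/-! Everything is read off from the projection of `i` to the spacelike factor `ℝ^d`, its shadow.
Since `q(i p - i p') = -2 - 2⟨i p, i p'⟩` and `q` is at most the squared norm of the first factor, a
spacelike immersion has a shadow that is bi-Lipschitz in small charts. Invariance of domain, proved
here for bi-Lipschitz maps by way of a Lipschitz no-retraction theorem, makes the shadow a local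
homeomorphism. A path over a segment is no longer than the segment, so completeness lets segments be
lifted, and the shadow is a homeomorphism onto `ℝ^d` (`isHomeomorph_shadow`). This gives the ball
and the embedding.

Write a point of the quadric as `(x, y)`. Then `‖y‖ = ‖(x, 1)‖`, so `⟨·,·⟩ < -1` says exactly that
the angle between the second factors is smaller than the angle between the lifts `(x, 1)` to the
hemisphere. This holds locally, and segments of `ℝ^d` are seen as great-circle arcs of the
hemisphere, along which angles add. The triangle inequality on the circle then makes the strict
contraction global (`form_lt`), and any two points of the image are space related.

After rescaling by `‖y‖`, the image is the graph of a contraction from the open hemisphere to the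
circle. It extends to the closed hemisphere, and its values on the equator give isotropic vectors
with pairwise nonpositive products. A negative product yields a spacelike geodesic, a zero product a
photon. The degenerate case of opposite vectors is excluded by the strict contraction
(`ne_neg_of_inner_le`). -/

/-- The determinant of `1 + t A` is a polynomial in `t` of degree at most the dimension. -/
theorem ContinuousLinearMap.exists_polynomial_det_one_add_smul [NormedSpace ℝ F]
    [FiniteDimensional ℝ F] (A : F →L[ℝ] F) :
    ∃ P : Polynomial ℝ, P.natDegree ≤ Module.finrank ℝ F ∧
      ∀ t : ℝ, P.eval t = (1 + t • A).det := by
  classical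
  let b := Module.finBasis ℝ F
  let M := LinearMap.toMatrix b b (A : F →ₗ[ℝ] F)
  have hdeg := Polynomial.natDegree_det_X_add_C_le M 1
  rw [Fintype.card_fin] at hdeg
  refine ⟨_, hdeg, fun t => ?_⟩
  have h1 : (1 + t • A).det = (1 + t • M).det := by
    have : ((1 + t • A : F →L[ℝ] F) : F →ₗ[ℝ] F) = 1 + t • (A : F →ₗ[ℝ] F) := rfl
    rw [ContinuousLinearMap.det, this, ← LinearMap.det_toMatrix b, map_add, map_smul,
      LinearMap.toMatrix_one]
  rw [h1, ← Polynomial.coe_evalRingHom, RingHom.map_det]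
  congr 1
  ext i j
  by_cases hij : i = j
  · subst hij; simp; ring
  · simp [hij]; ring

/-- A map that is Lipschitz on a ball and vanishes outside its interior is Lipschitz. -/
theorem LipschitzOnWith.lipschitzWith_of_eq_zero [NormedSpace ℝ F] {K : NNReal} {R : ℝ}
    {h : F → F} (hh : LipschitzOnWith K h (closedBall 0 R)) (h0 : ∀ x, R ≤ ‖x‖ → h x = 0) :
    LipschitzWith K h := by
  have key : ∀ x y, ‖x‖ ≤ R → R ≤ ‖y‖ → dist (h x) (h y) ≤ K * dist x y := by
    intro x y hx hy
    -- The segment crosses the sphere of radius `R`, where `h` vanishes; only the part inside the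
    -- ball contributes.
    obtain ⟨s, hs, hsR⟩ : R ∈ (fun s : ℝ => ‖AffineMap.lineMap (k := ℝ) x y s‖) '' Icc 0 1 := by
      apply intermediate_value_Icc zero_le_one
      · exact (AffineMap.lineMap_continuous.norm).continuousOn
      · simpa using ⟨hx, hy⟩
    have hz : h (AffineMap.lineMap (k := ℝ) x y s) = 0 := h0 _ hsR.ge
    have h1 := hh.dist_le_mul x (by simpa using hx) (AffineMap.lineMap (k := ℝ) x y s)
      (by simpa using hsR.le)
    rw [hz] at h1
    rw [h0 y hy]
    refine h1.trans ?_
    gcongr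
    rw [dist_left_lineMap]
    have : ‖s‖ ≤ 1 := by rw [Real.norm_eq_abs, abs_of_nonneg hs.1]; exact hs.2
    nlinarith [dist_nonneg (x := x) (y := y)]
  refine LipschitzWith.of_dist_le_mul fun x y => ?_
  rcases le_total ‖x‖ R with hx | hx <;> rcases le_total ‖y‖ R with hy | hy
  · exact hh.dist_le_mul x (by simpa using hx) y (by simpa using hy)
  · exact key x y hx hy
  · rw [dist_comm, dist_comm x]; exact key y x hy hx
  · rw [h0 x hx, h0 y hy, dist_self]; positivity

theorem ContinuousLinearMap.det_one [NormedSpace ℝ F] : (1 : F →L[ℝ] F).det = 1 := by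
  exact LinearMap.det_id

/-- A small Lipschitz perturbation of the identity, supported in a ball, preserves the volume of
the ball. -/
theorem eventually_integral_det_eq [NormedSpace ℝ F] [FiniteDimensional ℝ F] [MeasurableSpace F]
    [BorelSpace F] (μ : Measure F) [μ.IsAddHaarMeasure] {K : NNReal} {R : ℝ}
    {h : F → F} (hh : LipschitzWith K h) (h0 : ∀ x, R ≤ ‖x‖ → h x = 0) :
    ∀ᶠ t : ℝ in 𝓝[>] 0,
      IntegrableOn (fun x => (1 + t • fderiv ℝ h x).det) (ball 0 R) μ ∧
      ∫ x in ball 0 R, (1 + t • fderiv ℝ h x).det ∂μ = μ.real (ball 0 R) := by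
  -- the determinant is positive near the identity
  have hdet : ∀ᶠ t : ℝ in 𝓝[>] 0, ∀ A : F →L[ℝ] F, ‖A‖ ≤ K → 0 < (1 + t • A).det := by
    have hpos : ∀ᶠ L : F →L[ℝ] F in 𝓝 1, 0 < L.det := by
      refine ContinuousLinearMap.continuous_det.continuousAt.eventually_const_lt ?_
      exact one_pos.trans_eq ContinuousLinearMap.det_one.symm
    obtain ⟨ε, hε, hball⟩ := Metric.eventually_nhds_iff.1 hpos
    have : ∀ᶠ t : ℝ in 𝓝[>] 0, t * K < ε := by
      refine Filter.Eventually.filter_mono nhdsWithin_le_nhds ?_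
      exact (continuous_id.mul continuous_const).continuousAt.eventually_lt_const (by simpa using hε)
    filter_upwards [this, self_mem_nhdsWithin] with t ht ht0 A hA
    apply hball
    rw [dist_eq_norm, add_sub_cancel_left, norm_smul, Real.norm_eq_abs, abs_of_pos ht0]
    exact lt_of_le_of_lt (mul_le_mul_of_nonneg_left hA (le_of_lt ht0)) ht
  -- null sets are mapped to null sets
  have hnull : ∀ᶠ t : ℝ in 𝓝[>] 0, ∀ s : Set F, μ s = 0 → μ ((fun x => x + t • h x) '' s) = 0 := by
    -- Any bound above `det 1 = 1` would do: only its finiteness is used.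
    have h2 := addHaar_image_le_mul_of_det_lt μ (1 : F →L[ℝ] F) (m := 2)
      (by rw [ContinuousLinearMap.det_one]; simp)
    -- `K + 1` instead of `K`, so that the constant is positive even if `K = 0`.
    have ht : Tendsto (fun t : ℝ => Real.toNNReal t * (K + 1)) (𝓝[>] 0) (𝓝[>] 0) := by
      refine tendsto_nhdsWithin_iff.2 ⟨?_, ?_⟩
      · have : Continuous (fun t : ℝ => Real.toNNReal t * (K + 1)) := by fun_prop
        simpa using (this.tendsto 0).mono_left nhdsWithin_le_nhds
      · filter_upwards [self_mem_nhdsWithin] with t ht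
        have : 0 < Real.toNNReal t := by simpa using ht
        exact mul_pos this (by positivity)
    filter_upwards [ht.eventually h2, self_mem_nhdsWithin] with t ht ht0 s hs
    have := ht s (fun x => x + t • h x) ?_
    · rw [hs, mul_zero] at this
      exact le_antisymm this bot_le
    · rw [ApproximatesLinearOn.approximatesLinearOn_iff_lipschitzOnWith]
      have h3 : ((fun x => x + t • h x) - ⇑(1 : F →L[ℝ] F)) = fun x => t • h x := by
        ext x; simp
      rw [h3]
      refine LipschitzOnWith.of_dist_le_mul fun x _ y _ => ?_
      rw [dist_smul₀, Real.norm_eq_abs, abs_of_pos ht0]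
      push_cast
      rw [Real.coe_toNNReal _ (le_of_lt ht0), mul_assoc]
      refine mul_le_mul_of_nonneg_left ((hh.dist_le_mul x y).trans ?_) (le_of_lt ht0)
      gcongr
      simp
  -- bijectivity
  have hbij : ∀ᶠ t : ℝ in 𝓝[>] 0, Function.Bijective (fun x => x + t • h x) := by
    have : ∀ᶠ t : ℝ in 𝓝[>] 0, t * K < 1 / 2 := by
      refine Filter.Eventually.filter_mono nhdsWithin_le_nhds ?_
      exact (continuous_id.mul continuous_const).continuousAt.eventually_lt_const (by simp)
    filter_upwards [this, self_mem_nhdsWithin] with t ht ht0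
    have happ : ApproximatesLinearOn (fun x => x + t • h x)
        ((ContinuousLinearEquiv.refl ℝ F : F ≃L[ℝ] F) : F →L[ℝ] F) univ (1 / 2) := by
      rw [ApproximatesLinearOn.approximatesLinearOn_iff_lipschitzOnWith]
      have h3 : ((fun x => x + t • h x) -
          ⇑((ContinuousLinearEquiv.refl ℝ F : F ≃L[ℝ] F) : F →L[ℝ] F)) = fun x => t • h x := by
        ext x; simp
      rw [h3]
      refine LipschitzOnWith.of_dist_le_mul fun x _ y _ => ?_
      rw [dist_smul₀, Real.norm_eq_abs, abs_of_pos ht0]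
      push_cast
      have := mul_le_mul_of_nonneg_left (hh.dist_le_mul x y) (le_of_lt ht0)
      nlinarith [dist_nonneg (x := x) (y := y)]
    have hc : Subsingleton F ∨ (1 / 2 : NNReal) <
        ‖(((ContinuousLinearEquiv.refl ℝ F).symm : F ≃L[ℝ] F) : F →L[ℝ] F)‖₊⁻¹ := by
      rcases subsingleton_or_nontrivial F with hF | hF
      · exact Or.inl hF
      · right
        have : (((ContinuousLinearEquiv.refl ℝ F).symm : F ≃L[ℝ] F) : F →L[ℝ] F) =
          ContinuousLinearMap.id ℝ F := by ext; simp
        rw [this, ContinuousLinearMap.nnnorm_id, inv_one]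
        exact NNReal.half_lt_self one_ne_zero
    exact (happ.toHomeomorph _ hc).bijective
  -- The map `id + t h` permutes the ball. By Rademacher's theorem it is differentiable off a null
  -- set, whose image is null, so the change of variables formula computes the volume of the ball.
  filter_upwards [hdet, hnull, hbij, self_mem_nhdsWithin] with t hdet hnull hbij ht0
  set D := {x | DifferentiableAt ℝ h x} with hD
  have hDm : MeasurableSet D := measurableSet_of_differentiableAt ℝ h
  have hDae : ∀ᵐ x ∂μ, x ∈ D := hh.ae_differentiableAt
  -- Outside the ball the map is the identity, so injectivity prevents interior points from leaving
  -- and surjectivity fills the ball.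
  have himage : (fun x => x + t • h x) '' ball 0 R = ball 0 R := by
    have hc : ∀ x, x ∉ ball (0 : F) R → x + t • h x = x := fun x hx => by
      rw [h0 x (by simpa using hx)]; simp
    apply Subset.antisymm
    · rintro _ ⟨x, hx, rfl⟩
      by_contra hy
      have : x = x + t • h x := hbij.1 (hc _ hy).symm
      dsimp only at hy
      rw [← this] at hy
      exact hy hx
    · intro y hy
      obtain ⟨x, rfl⟩ := hbij.2 y
      refine ⟨x, ?_, rfl⟩
      by_contra hx
      dsimp only at hy
      rw [hc x hx] at hy
      exact hx hy
  have hmeas : μ ((fun x => x + t • h x) '' (ball 0 R ∩ D)) = μ (ball 0 R) := by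
    apply le_antisymm
    · conv_rhs => rw [← himage]
      exact measure_mono (image_mono inter_subset_left)
    · conv_lhs => rw [← himage, ← inter_union_sdiff (ball 0 R) D, image_union]
      refine (measure_union_le _ _).trans ?_
      rw [hnull (ball 0 R \ D) (measure_mono_null (fun x hx => hx.2) (ae_iff.1 hDae)), add_zero]
  have hder : ∀ x ∈ ball (0 : F) R ∩ D, HasFDerivWithinAt (fun x => x + t • h x)
      (1 + t • fderiv ℝ h x) (ball (0 : F) R ∩ D) x := fun x hx =>
    ((hasFDerivAt_id x).add
      ((show DifferentiableAt ℝ h x from hx.2).hasFDerivAt.const_smul t)).hasFDerivWithinAt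
  have hcv := lintegral_abs_det_fderiv_eq_addHaar_image μ (measurableSet_ball.inter hDm) hder
    hbij.1.injOn
  rw [hmeas] at hcv
  have hcv2 : ∫⁻ x in ball 0 R, ENNReal.ofReal ((1 + t • fderiv ℝ h x).det) ∂μ = μ (ball 0 R) := by
    rw [← hcv]
    have hs : (ball (0 : F) R ∩ D : Set F) =ᵐ[μ] ball (0 : F) R :=
      inter_ae_eq_left_of_ae_eq_univ (eventuallyEq_univ.2 hDae)
    rw [setLIntegral_congr hs]
    refine lintegral_congr fun x => ?_
    rw [abs_of_pos]
    exact hdet _ (norm_fderiv_le_of_lipschitz ℝ hh)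
  have hm : Measurable fun x => (1 + t • fderiv ℝ h x).det :=
    ContinuousLinearMap.continuous_det.measurable.comp
      (((measurable_fderiv ℝ h).const_smul t).const_add 1)
  have hnn : ∀ x, 0 ≤ (1 + t • fderiv ℝ h x).det :=
    fun x => (hdet _ (norm_fderiv_le_of_lipschitz ℝ hh)).le
  refine ⟨⟨hm.aestronglyMeasurable, ?_⟩, ?_⟩
  · rw [hasFiniteIntegral_iff_ofReal (ae_of_all _ hnn), hcv2]
    exact measure_ball_lt_top
  · rw [integral_eq_lintegral_of_nonneg_ae (ae_of_all _ hnn) hm.aestronglyMeasurable, hcv2]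
    rfl

/-- The degree formula for a Lipschitz self-map of a ball that is the identity near the boundary. -/
theorem integral_det_one_add_fderiv_eq [NormedSpace ℝ F] [FiniteDimensional ℝ F]
    [MeasurableSpace F] [BorelSpace F] (μ : Measure F) [μ.IsAddHaarMeasure] {K : NNReal} {R : ℝ}
    {h : F → F} (hh : LipschitzWith K h) (h0 : ∀ x, R ≤ ‖x‖ → h x = 0) :
    ∫ x in ball 0 R, (1 + fderiv ℝ h x).det ∂μ = μ.real (ball 0 R) := by
  classical
  have hev := eventually_integral_det_eq μ hh h0
  obtain ⟨ε, hε, hsub⟩ := mem_nhdsGT_iff_exists_Ioo_subset.1 hev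
  rw [mem_Ioi] at hε
  set n := Module.finrank ℝ F + 1
  -- Distinct nodes in `(0, ε)`; the shift by 2 keeps the first one strictly below `ε`.
  let v : ℕ → ℝ := fun j => ε / (j + 2)
  have hv : InjOn v (Finset.range n) := by
    intro a _ b _ hab
    simp only [v] at hab
    rw [div_eq_div_iff (by positivity) (by positivity)] at hab
    have := mul_left_cancel₀ hε.ne' hab
    have : (b : ℝ) = a := by linarith
    exact_mod_cast this.symm
  have hv' : ∀ j, v j ∈ Ioo 0 ε := fun j =>
    ⟨by positivity, by
      simp only [v]
      rw [div_lt_iff₀ (by positivity)]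
      nlinarith [(Nat.cast_nonneg j : (0 : ℝ) ≤ j)]⟩
  let c : ℕ → ℝ := fun j => (Lagrange.basis (Finset.range n) v j).eval 1
  -- The value at `t = 1` is interpolated from small values of `t`, with weights that do not depend
  -- on `A`, so that the identity can be integrated.
  have hexp : ∀ A : F →L[ℝ] F,
      (1 + A).det = ∑ j ∈ Finset.range n, (1 + v j • A).det * c j := by
    intro A
    obtain ⟨P, hP, hPt⟩ := A.exists_polynomial_det_one_add_smul
    have h1 := Lagrange.eq_interpolate (f := P) hv (by
      rw [Finset.card_range]
      exact lt_of_le_of_lt Polynomial.degree_le_natDegree (by exact_mod_cast Nat.lt_succ_of_le hP))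
    have h2 := congrArg (Polynomial.eval 1) h1
    rw [hPt, one_smul, Lagrange.interpolate_apply, Polynomial.eval_finsetSum] at h2
    rw [h2]
    refine Finset.sum_congr rfl fun j _ => ?_
    rw [Polynomial.eval_mul, Polynomial.eval_C, hPt]
  rw [integral_congr_ae (ae_of_all _ fun x => hexp (fderiv ℝ h x))]
  rw [integral_finsetSum _ fun j _ => (hsub (hv' j)).1.mul_const _]
  simp_rw [integral_mul_const]
  rw [Finset.sum_congr rfl fun j _ => by rw [(hsub (hv' j)).2], ← Finset.mul_sum]
  -- Interpolation is exact on the constant polynomial 1.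
  have : ∑ j ∈ Finset.range n, c j = 1 := by
    have := congrArg (Polynomial.eval 1)
      (Lagrange.sum_basis hv (Finset.nonempty_range_iff.2 (Nat.succ_ne_zero _)))
    rw [Polynomial.eval_finsetSum, Polynomial.eval_one] at this
    exact this
  rw [this, mul_one]

end LipschitzDegree

/-! ### No Lipschitz retraction, and invariance of domain for bi-Lipschitz maps. -/

section InvarianceOfDomain

open MeasureTheory

variable {F : Type*} [NormedAddCommGroup F] [InnerProductSpace ℝ F]

/-- There is no Lipschitz retraction of a ball onto its boundary sphere. -/
theorem LipschitzOnWith.exists_norm_ne_of_eq_id_on_sphere [FiniteDimensional ℝ F] {K : NNReal} {R : ℝ} (hR : 0 < R)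
    {r : F → F} (hr : LipschitzOnWith K r (closedBall 0 R)) (hid : ∀ x, ‖x‖ = R → r x = x) :
    ∃ x ∈ closedBall (0 : F) R, ‖r x‖ ≠ R := by
  by_contra! hcon
  borelize F
  let h : F → F := fun x => if ‖x‖ ≤ R then r x - x else 0
  have hin : ∀ x, ‖x‖ ≤ R → h x = r x - x := fun x hx => if_pos hx
  have h0 : ∀ x, R ≤ ‖x‖ → h x = 0 := by
    intro x hx
    rcases hx.eq_or_lt with hx | hx
    · rw [hin x hx.ge, hid x hx.symm, sub_self]
    · exact if_neg (not_le.2 hx)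
  have hLip : LipschitzOnWith (K + 1) h (closedBall 0 R) := by
    have h1 : LipschitzOnWith (K + 1) (fun x => r x - x) (closedBall 0 R) :=
      hr.sub LipschitzWith.id.lipschitzOnWith
    intro x hx y hy
    rw [hin x (by simpa using hx), hin y (by simpa using hy)]
    exact h1 hx hy
  have hLip' := hLip.lipschitzWith_of_eq_zero h0
  have hint := integral_det_one_add_fderiv_eq (volume : Measure F) hLip' h0
  -- Differentiating `‖r‖² = R²` shows that `r x` is orthogonal to the range of the derivative of
  -- `r` at `x`. An invertible derivative would have `r x` in its range, forcing `r x = 0`.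
  have hzero : ∫ x in ball 0 R, (1 + fderiv ℝ h x).det = 0 := by
    rw [← integral_zero F ℝ (μ := (volume : Measure F).restrict (ball 0 R))]
    refine setIntegral_congr_ae measurableSet_ball ?_
    filter_upwards [hLip'.ae_differentiableAt (μ := volume)] with x hx hxR
    have hd : HasFDerivAt (fun y => y + h y) (1 + fderiv ℝ h x) x :=
      (hasFDerivAt_id x).add hx.hasFDerivAt
    have hev : (fun y => ‖y + h y‖ ^ 2) =ᶠ[𝓝 x] fun _ => R ^ 2 := by
      filter_upwards [isOpen_ball.mem_nhds hxR] with y hy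
      have hy' : ‖y‖ ≤ R := by simpa using (ball_subset_closedBall hy)
      rw [hin y hy', add_sub_cancel, hcon y (ball_subset_closedBall hy)]
    have hd2 := hd.norm_sq
    have hd3 := hd2.unique ((hasFDerivAt_const (R ^ 2) x).congr_of_eventuallyEq hev)
    have hx' : ‖x‖ ≤ R := by simpa using (ball_subset_closedBall hxR)
    have hne : x + h x ≠ 0 := by
      rw [hin x hx', add_sub_cancel, ← norm_ne_zero_iff, hcon x (ball_subset_closedBall hxR)]
      exact hR.ne'
    by_contra hdet
    let e := LinearMap.equivOfDetNeZero ((1 + fderiv ℝ h x : F →L[ℝ] F) : F →ₗ[ℝ] F) hdet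
    have he : (1 + fderiv ℝ h x) (e.symm (x + h x)) = x + h x := e.apply_symm_apply _
    have h3 : 2 • inner ℝ (x + h x) ((1 + fderiv ℝ h x) (e.symm (x + h x))) = 0 :=
      congrArg (fun L : F →L[ℝ] ℝ => L (e.symm (x + h x))) hd3
    rw [he, real_inner_self_eq_norm_sq] at h3
    exact hne (by simpa using h3)
  rw [hzero] at hint
  have := Metric.measure_ball_pos (volume : Measure F) (0 : F) hR
  have h2 : 0 < (volume : Measure F).real (ball 0 R) :=
    ENNReal.toReal_pos this.ne' measure_ball_lt_top.ne
  exact h2.ne hint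

/-- Normalization is `C¹` off the origin; it turns a map without zeros into a retraction onto a
sphere. -/
theorem locallyLipschitzOn_inv_norm_smul :
    LocallyLipschitzOn {y : F | y ≠ 0} (fun y => ‖y‖⁻¹ • y) := by
  intro y hy
  have : ContDiffAt ℝ 1 (fun y : F => ‖y‖⁻¹ • y) y :=
    ((contDiffAt_norm ℝ hy).inv (norm_ne_zero_iff.2 hy)).smul contDiffAt_id
  obtain ⟨K, t, ht, hK⟩ := this.exists_lipschitzOnWith
  exact ⟨K, t, mem_nhdsWithin_of_mem_nhds ht, hK⟩

/-- A Lipschitz map of a ball that is the identity on the boundary sphere has a zero. -/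
theorem LipschitzOnWith.exists_eq_zero_of_eq_id_on_sphere [FiniteDimensional ℝ F] {K : NNReal} {R : ℝ} (hR : 0 < R)
    {g : F → F} (hg : LipschitzOnWith K g (closedBall 0 R)) (hid : ∀ x, ‖x‖ = R → g x = x) :
    ∃ x ∈ closedBall (0 : F) R, g x = 0 := by
  by_contra! hcon
  have hloc : LocallyLipschitzOn (closedBall 0 R) (fun x => R • (‖g x‖⁻¹ • g x)) := by
    intro x hx
    obtain ⟨L, t, ht, hL⟩ := locallyLipschitzOn_inv_norm_smul (hcon x hx)
    have ht' : t ∈ 𝓝 (g x) := by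
      rwa [(isOpen_ne.nhdsWithin_eq (hcon x hx))] at ht
    refine ⟨‖R‖₊ * (L * K), closedBall 0 R ∩ g ⁻¹' t, inter_mem self_mem_nhdsWithin
      (hg.continuousOn x hx ht'), ?_⟩
    have h1 : LipschitzOnWith (L * K) (fun x => ‖g x‖⁻¹ • g x) (closedBall 0 R ∩ g ⁻¹' t) :=
      hL.comp (hg.mono inter_subset_left) (fun y hy => hy.2)
    exact (lipschitzWith_smul R).comp_lipschitzOnWith h1
  obtain ⟨L, hL⟩ := hloc.exists_lipschitzOnWith_of_compact (isCompact_closedBall _ _)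
  obtain ⟨x, hx, hne⟩ := hL.exists_norm_ne_of_eq_id_on_sphere hR (fun x hx => by
    rw [hid x hx, hx, smul_smul, mul_inv_cancel₀ hR.ne', one_smul])
  apply hne
  rw [norm_smul, norm_smul, norm_inv, norm_norm, inv_mul_cancel₀ (norm_ne_zero_iff.2 (hcon x hx)),
    mul_one, Real.norm_of_nonneg hR.le]

/-- A Lipschitz map of a ball that is close to the identity has a zero. -/
theorem LipschitzOnWith.exists_eq_zero_of_norm_sub_le [FiniteDimensional ℝ F] {K : NNReal} {R : ℝ} (hR : 0 < R)
    {g : F → F} (hg : LipschitzOnWith K g (closedBall 0 R))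
    (hclose : ∀ x ∈ closedBall (0 : F) R, ‖g x - x‖ ≤ R / 2) :
    ∃ x ∈ closedBall (0 : F) R, g x = 0 := by
  -- A cutoff equal to 1 for `‖x‖ ≤ R / 2` and to 0 on the sphere. The map `x + χ x • (g x - x)` is
  -- the identity on the sphere, hence has a zero; there `‖x‖ ≤ ‖g x - x‖ ≤ R / 2`, so `χ x = 1` and
  -- `g x = 0`.
  let χ : F → ℝ := fun x => min 1 (2 - 2 / R * ‖x‖)
  have hχL : LipschitzWith ⟨2 / R, by positivity⟩ χ := by
    refine LipschitzWith.const_min ?_ 1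
    refine LipschitzWith.of_dist_le_mul fun x y => ?_
    rw [Real.dist_eq, dist_eq_norm]
    have : 2 - 2 / R * ‖x‖ - (2 - 2 / R * ‖y‖) = 2 / R * (‖y‖ - ‖x‖) := by ring
    rw [this, abs_mul, abs_of_pos (by positivity : 0 < 2 / R), norm_sub_rev]
    exact mul_le_mul_of_nonneg_left (abs_norm_sub_norm_le y x) (by positivity)
  have hχ01 : ∀ x ∈ closedBall (0 : F) R, 0 ≤ χ x ∧ χ x ≤ 1 := by
    intro x hx
    have hx : ‖x‖ ≤ R := by simpa using hx
    refine ⟨le_min zero_le_one ?_, min_le_left _ _⟩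
    have : 2 / R * ‖x‖ ≤ 2 / R * R := by gcongr
    rw [div_mul_cancel₀ _ hR.ne'] at this
    linarith
  have hL : LipschitzOnWith (1 + (1 * (K + 1) + ⟨R / 2, by positivity⟩ * ⟨2 / R, by positivity⟩))
      (fun x => x + χ x • (g x - x)) (closedBall 0 R) := by
    refine LipschitzOnWith.add LipschitzWith.id.lipschitzOnWith ?_
    have h1 : LipschitzOnWith (K + 1) (fun x => g x - x) (closedBall 0 R) :=
      hg.sub LipschitzWith.id.lipschitzOnWith
    refine LipschitzOnWith.of_dist_le_mul fun x hx y hy => ?_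
    have e : χ x • (g x - x) - χ y • (g y - y) =
      χ x • ((g x - x) - (g y - y)) + (χ x - χ y) • (g y - y) := by module
    rw [dist_eq_norm, e]
    refine (norm_add_le _ _).trans ?_
    rw [norm_smul, norm_smul]
    have a1 := h1.dist_le_mul x hx y hy
    have a2 := hχL.dist_le_mul x y
    rw [dist_eq_norm] at a1
    rw [dist_eq_norm] at a2
    have a3 := hclose y hy
    have a4 : ‖χ x‖ ≤ 1 := by
      rw [Real.norm_of_nonneg (hχ01 x hx).1]; exact (hχ01 x hx).2
    push_cast at a1 a2 ⊢
    have b1 := mul_le_mul a4 a1 (norm_nonneg _) zero_le_one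
    have b2 := mul_le_mul a2 a3 (norm_nonneg _) ((norm_nonneg _).trans a2)
    change _ ≤ 2 / R * dist x y * (R / 2) at b2
    change _ ≤ (1 * ((K : ℝ) + 1) + R / 2 * (2 / R)) * dist x y
    linarith
  obtain ⟨x, hx, hx0⟩ := hL.exists_eq_zero_of_eq_id_on_sphere hR (fun x hx => by
    have : χ x = 0 := by
      simp only [χ, hx, div_mul_cancel₀ _ hR.ne']; norm_num
    rw [this, zero_smul, add_zero])
  refine ⟨x, hx, ?_⟩
  have hxn : ‖x‖ ≤ R / 2 := by
    have : x = -(χ x • (g x - x)) := eq_neg_of_add_eq_zero_left hx0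
    rw [this, norm_neg, norm_smul, Real.norm_of_nonneg (hχ01 x hx).1]
    nlinarith [hclose x hx, (hχ01 x hx).1, (hχ01 x hx).2, norm_nonneg (g x - x)]
  have hχ1 : χ x = 1 := by
    apply min_eq_left
    have : 2 / R * ‖x‖ ≤ 2 / R * (R / 2) := by gcongr
    rw [show 2 / R * (R / 2) = 1 by field_simp] at this
    linarith
  rw [hχ1, one_smul, add_sub_cancel] at hx0
  exact hx0

/-- Lipschitz maps multiply Hausdorff measure by a bounded factor. Applied to a sphere, this lets a
generic point avoid its image. -/
theorem LipschitzWith.hausdorffMeasure_image_eq_zero [FiniteDimensional ℝ F] [MeasurableSpace F] [BorelSpace F]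
    {K : NNReal} {g : F → F} (hg : LipschitzWith K g) {s : Set F}
    (hs : μH[(Module.finrank ℝ F : ℝ)] s = 0) : μH[(Module.finrank ℝ F : ℝ)] (g '' s) = 0 := by
  have := hg.hausdorffMeasure_image_le (d := (Module.finrank ℝ F : ℝ)) (by positivity) s
  rw [hs, mul_zero] at this
  exact le_antisymm this bot_le

/-- The radial map that pushes a ball punctured at its centre onto its boundary sphere. -/
theorem locallyLipschitzOn_radial (y₀ : F) (ε : ℝ) :
    LocallyLipschitzOn {y : F | y ≠ y₀} (fun y => y₀ + max 1 (ε * ‖y - y₀‖⁻¹) • (y - y₀)) := by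
  have hc : LocallyLipschitzOn {y : F | y ≠ y₀} (fun y => max 1 (ε * ‖y - y₀‖⁻¹)) := by
    intro y hy
    have : ContDiffAt ℝ 1 (fun y : F => ε * ‖y - y₀‖⁻¹) y :=
      contDiffAt_const.mul
        (((contDiffAt_id.sub contDiffAt_const).norm ℝ (sub_ne_zero.2 hy)).inv
          (norm_ne_zero_iff.2 (sub_ne_zero.2 hy)))
    obtain ⟨K, t, ht, hK⟩ := this.exists_lipschitzOnWith
    refine ⟨K, t, mem_nhdsWithin_of_mem_nhds ht, ?_⟩
    refine LipschitzOnWith.of_dist_le_mul fun a ha b hb => ?_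
    rw [Real.dist_eq]
    refine le_trans ?_ (hK.dist_le_mul a ha b hb)
    rw [Real.dist_eq]
    simpa using abs_max_sub_max_le_max 1 (ε * ‖a - y₀‖⁻¹) 1 (ε * ‖b - y₀‖⁻¹)
  intro y hy
  obtain ⟨K, t, ht, hK⟩ := hc hy
  have hbd : ∀ᶠ z in 𝓝[{y | y ≠ y₀}] y, ‖z - y₀‖ < ‖y - y₀‖ + 1 ∧
      ‖max 1 (ε * ‖z - y₀‖⁻¹)‖ < ‖max 1 (ε * ‖y - y₀‖⁻¹)‖ + 1 := by
    refine Filter.Eventually.and ?_ ?_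
    · have : Continuous fun z : F => ‖z - y₀‖ := by fun_prop
      exact (this.continuousAt.eventually_lt_const (by linarith)).filter_mono nhdsWithin_le_nhds
    · exact (hc.continuousOn.norm y hy).eventually_lt_const (by linarith)
  refine ⟨0 + (Real.toNNReal (‖max 1 (ε * ‖y - y₀‖⁻¹)‖ + 1) * (1 + 0) +
    K * Real.toNNReal (‖y - y₀‖ + 1)), t ∩ _, inter_mem ht hbd, ?_⟩
  refine (LipschitzWith.const y₀).lipschitzOnWith.add ?_
  refine LipschitzOnWith.of_dist_le_mul fun a ha b hb => ?_
  have a1 := hK.dist_le_mul a ha.1 b hb.1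
  obtain ⟨-, a2⟩ := ha.2
  obtain ⟨b3, -⟩ := hb.2
  set p : F → ℝ := fun z => max 1 (ε * ‖z - y₀‖⁻¹)
  have e : p a • (a - y₀) - p b • (b - y₀) = p a • (a - b) + (p a - p b) • (b - y₀) := by module
  change dist (p a • (a - y₀)) (p b • (b - y₀)) ≤ _
  rw [dist_eq_norm, e]
  refine (norm_add_le _ _).trans ?_
  rw [norm_smul, norm_smul, ← dist_eq_norm, ← dist_eq_norm]
  push_cast
  rw [Real.coe_toNNReal _ (by positivity), Real.coe_toNNReal _ (by positivity)]
  have c1 := mul_le_mul_of_nonneg_right a2.le (dist_nonneg (x := a) (y := b))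
  have c2 := mul_le_mul a1 b3.le (norm_nonneg _) (by positivity)
  change ‖p a‖ * dist a b ≤ (‖p y‖ + 1) * dist a b at c1
  change _ ≤ ((‖p y‖ + 1) * (1 + 0) + K * (‖y - y₀‖ + 1)) * dist a b
  change dist (p a) (p b) * _ ≤ _ at c2
  linarith

/-- **Invariance of domain for bi-Lipschitz maps**. -/
theorem image_closedBall_mem_nhds_of_biLipschitz [FiniteDimensional ℝ F] {K : NNReal} {C : ℝ} (hC : 0 < C) {f : F → F}
    {c : F} {R : ℝ} (hR : 0 < R) (hf : LipschitzOnWith K f (closedBall c R))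
    (hanti : ∀ x ∈ closedBall c R, ∀ y ∈ closedBall c R, dist x y ≤ C * dist (f x) (f y)) :
    f '' closedBall c R ∈ 𝓝 (f c) := by
  borelize F
  rcases subsingleton_or_nontrivial F with hsub | hnon
  · convert univ_mem
    refine eq_univ_of_forall fun y => ⟨c, mem_closedBall_self hR.le, Subsingleton.elim _ _⟩
  have hcB : c ∈ closedBall c R := mem_closedBall_self hR.le
  -- a Lipschitz extension of the inverse
  obtain ⟨L, G, hG, hGf⟩ : ∃ (L : NNReal) (G : F → F), LipschitzWith L G ∧
      ∀ x ∈ closedBall c R, G (f x) = x := by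
    have hinj : InjOn f (closedBall c R) := fun x hx y hy hxy => by
      have := hanti x hx y hy
      rw [hxy, dist_self, mul_zero] at this
      exact dist_le_zero.1 this
    have : LipschitzOnWith (Real.toNNReal C) (Function.invFunOn f (closedBall c R))
        (f '' closedBall c R) := by
      rintro _ ⟨x, hx, rfl⟩ _ ⟨y, hy, rfl⟩
      rw [hinj.leftInvOn_invFunOn hx, hinj.leftInvOn_invFunOn hy, edist_dist, edist_dist,
        ← ENNReal.ofReal_coe_nnreal, ← ENNReal.ofReal_mul (by positivity),
        Real.coe_toNNReal _ hC.le]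
      exact ENNReal.ofReal_le_ofReal (hanti x hx y hy)
    obtain ⟨G, hG, hGe⟩ := this.extend_finite_dimension
    exact ⟨_, G, hG, fun x hx => by
      rw [← hGe (mem_image_of_mem f hx), hinj.leftInvOn_invFunOn hx]⟩
  -- Suppose that a point `y₀` near `f c` is omitted. Let `Φ` push the values of `f` out of the
  -- `ε`-ball at `y₀`, then apply `G`. The result is close to the identity, so it takes the value `c
  -- + v` at some `c + x`. If `f (c + x)` is `ε`-far from `y₀`, then `x = v`, but `f (c + v)` is
  -- `ε`-close to `y₀`. Otherwise `c + v` lies in the `G`-image of a sphere, which `v` was chosen to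
  -- avoid.
  by_contra hcon
  -- The total displacement allowed is `R / 2`: a quarter of `R` for the push by `Φ`, a quarter for
  -- `v`.
  obtain ⟨ε, hε, hεL⟩ : ∃ ε : ℝ, 0 < ε ∧ L * ε ≤ R / 4 := by
    refine ⟨R / (4 * (L + 1)), by positivity, ?_⟩
    rw [mul_div_assoc', div_le_div_iff₀ (by positivity) (by positivity)]
    nlinarith [L.coe_nonneg]
  -- a point close to `f c` that is omitted
  obtain ⟨y₀, hy₀, hy₀f⟩ : ∃ y₀, dist y₀ (f c) < ε / 2 ∧ y₀ ∉ f '' closedBall c R := by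
    by_contra! h
    exact hcon (mem_of_superset (ball_mem_nhds _ (half_pos hε)) fun y hy => h y hy)
  -- a small vector such that `c + v` is not in the image of the sphere
  obtain ⟨v, hvR, hvK, hvB, hvS⟩ : ∃ v : F, ‖v‖ ≤ R / 4 ∧ K * ‖v‖ < ε / 2 ∧
      c + v ∈ closedBall c R ∧ c + v ∉ G '' sphere y₀ ε := by
    have : (μH[(Module.finrank ℝ F : ℝ)] : Measure F).IsAddHaarMeasure :=
      isAddHaarMeasure_hausdorffMeasure
    have hnull := hG.hausdorffMeasure_image_eq_zero
      (Measure.addHaar_sphere (μH[(Module.finrank ℝ F : ℝ)] : Measure F) y₀ ε)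
    set δ := min (R / 4) (ε / (4 * (K + 1))) with hδ
    have hδ0 : 0 < δ := by positivity
    obtain ⟨w, hw, hwS⟩ : ∃ w ∈ ball c δ, w ∉ G '' sphere y₀ ε := by
      by_contra! h
      have := measure_mono_null h hnull
      exact (Metric.measure_ball_pos _ c hδ0).ne' this
    have hwn : ‖w - c‖ < δ := by rwa [mem_ball, dist_eq_norm] at hw
    refine ⟨w - c, hwn.le.trans (min_le_left _ _), ?_, ?_, by rwa [add_sub_cancel]⟩
    · have h1 : ‖w - c‖ < ε / (4 * (K + 1)) := hwn.trans_le (min_le_right _ _)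
      rw [lt_div_iff₀ (by positivity)] at h1
      nlinarith [K.coe_nonneg, norm_nonneg (w - c)]
    · rw [add_sub_cancel, mem_closedBall, dist_eq_norm]
      have := hwn.le.trans (min_le_left _ _)
      linarith
  set Φ : F → F := fun y => y₀ + max 1 (ε * ‖y - y₀‖⁻¹) • (y - y₀) with hΦ
  have hne : ∀ x ∈ closedBall c R, f x ≠ y₀ := fun x hx h => hy₀f ⟨x, hx, h⟩
  have hΦfar : ∀ y, ε ≤ ‖y - y₀‖ → Φ y = y := by
    intro y hy
    have : ε * ‖y - y₀‖⁻¹ ≤ 1 := by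
      rw [← div_eq_mul_inv]; exact (div_le_one (hε.trans_le hy)).2 hy
    simp [Φ, max_eq_left this]
  have hΦnear : ∀ y, y ≠ y₀ → ‖y - y₀‖ ≤ ε → Φ y ∈ sphere y₀ ε ∧ dist (Φ y) y ≤ ε := by
    intro y hy hyε
    have hpos : 0 < ‖y - y₀‖ := norm_pos_iff.2 (sub_ne_zero.2 hy)
    have h1 : 1 ≤ ε * ‖y - y₀‖⁻¹ := by
      rw [← div_eq_mul_inv]; exact (one_le_div hpos).2 hyε
    constructor
    · simp only [Φ, max_eq_right h1, mem_sphere, dist_eq_norm, add_sub_cancel_left, norm_smul]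
      rw [Real.norm_of_nonneg (by positivity), mul_assoc, inv_mul_cancel₀ hpos.ne', mul_one]
    · have : Φ y - y = (ε * ‖y - y₀‖⁻¹ - 1) • (y - y₀) := by
        simp only [Φ, max_eq_right h1]; module
      rw [dist_eq_norm, this, norm_smul, Real.norm_of_nonneg (by linarith), sub_mul, mul_assoc,
        inv_mul_cancel₀ hpos.ne']
      linarith
  -- the perturbed composition
  have hloc : LocallyLipschitzOn (closedBall (0 : F) R)
      (fun x => G (Φ (f (c + x))) - (c + v)) := by
    have hmem : ∀ x ∈ closedBall (0 : F) R, c + x ∈ closedBall c R := fun x hx => by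
      simpa [dist_eq_norm] using hx
    intro x hx
    obtain ⟨M, t, ht, hM⟩ := locallyLipschitzOn_radial y₀ ε (hne _ (hmem x hx))
    have ht' : t ∈ 𝓝 (f (c + x)) := by
      rwa [(isOpen_ne.nhdsWithin_eq (hne _ (hmem x hx)))] at ht
    have hfL : LipschitzOnWith (K * 1) (fun x => f (c + x)) (closedBall (0 : F) R) := by
      refine hf.comp (LipschitzOnWith.of_dist_le_mul fun a _ b _ => by simp) hmem
    refine ⟨L * (M * (K * 1)) + 0, closedBall 0 R ∩ (fun x => f (c + x)) ⁻¹' t,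
      inter_mem self_mem_nhdsWithin (hfL.continuousOn x hx ht'), ?_⟩
    refine LipschitzOnWith.sub ?_ (LipschitzWith.const _).lipschitzOnWith
    exact hG.comp_lipschitzOnWith (hM.comp (hfL.mono inter_subset_left) fun y hy => hy.2)
  obtain ⟨M, hM⟩ := hloc.exists_lipschitzOnWith_of_compact (isCompact_closedBall _ _)
  have hcase : ∀ x ∈ closedBall (0 : F) R, G (Φ (f (c + x))) = c + x ∧ ε ≤ ‖f (c + x) - y₀‖ ∨
      Φ (f (c + x)) ∈ sphere y₀ ε ∧ dist (G (Φ (f (c + x)))) (c + x) ≤ R / 4 := by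
    intro x hx
    have hmem : c + x ∈ closedBall c R := by simpa [dist_eq_norm] using hx
    rcases le_total ε ‖f (c + x) - y₀‖ with h | h
    · exact Or.inl ⟨by rw [hΦfar _ h, hGf _ hmem], h⟩
    · obtain ⟨h1, h2⟩ := hΦnear _ (hne _ hmem) h
      refine Or.inr ⟨h1, ?_⟩
      calc dist (G (Φ (f (c + x)))) (c + x) = dist (G (Φ (f (c + x)))) (G (f (c + x))) := by
            rw [hGf _ hmem]
        _ ≤ L * dist (Φ (f (c + x))) (f (c + x)) :=
            hG.dist_le_mul _ _
        _ ≤ L * ε := by gcongr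
        _ ≤ R / 4 := hεL
  obtain ⟨x, hx, hx0⟩ := hM.exists_eq_zero_of_norm_sub_le hR (by
    intro x hx
    have e : G (Φ (f (c + x))) - (c + v) - x = (G (Φ (f (c + x))) - (c + x)) - v := by abel
    rw [e]
    refine (norm_sub_le _ _).trans ?_
    have : ‖G (Φ (f (c + x))) - (c + x)‖ ≤ R / 4 := by
      rcases hcase x hx with ⟨h, -⟩ | ⟨-, h⟩
      · rw [h, sub_self, norm_zero]; positivity
      · rwa [← dist_eq_norm]
    linarith)
  have hx1 : G (Φ (f (c + x))) = c + v := sub_eq_zero.1 hx0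
  rcases hcase x hx with ⟨h, h'⟩ | ⟨h, -⟩
  · rw [h] at hx1
    rw [hx1, ← dist_eq_norm] at h'
    have h2 := hf.dist_le_mul _ hvB _ hcB
    rw [dist_self_add_left] at h2
    have := dist_triangle (f (c + v)) (f c) y₀
    rw [dist_comm (f c)] at this
    linarith
  · exact hvS ⟨_, h, hx1⟩

end InvarianceOfDomain

/-! ### The form of signature `(d, 2)` and the local behaviour of the shadow. -/

namespace AdSGeometry

noncomputable section

variable {d : ℕ}

theorem form_eq (x y : V d) : form x y = inner ℝ x.1 y.1 - inner ℝ x.2 y.2 := by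
  simp [form, PiLp.inner_apply, mul_comm]

theorem form_comm (x y : V d) : form x y = form y x := by
  rw [form_eq, form_eq, real_inner_comm, real_inner_comm x.2]

theorem form_add_left (x y z : V d) : form (x + y) z = form x z + form y z := by
  simp only [form_eq, Prod.fst_add, Prod.snd_add, inner_add_left]; ring

theorem form_smul_left (c : ℝ) (x z : V d) : form (c • x) z = c * form x z := by
  simp only [form_eq, Prod.smul_fst, Prod.smul_snd, real_inner_smul_left]; ring

theorem form_add_right (x y z : V d) : form z (x + y) = form z x + form z y := by
  rw [form_comm, form_add_left, form_comm x, form_comm y]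

theorem form_smul_right (c : ℝ) (x z : V d) : form z (c • x) = c * form z x := by
  rw [form_comm, form_smul_left, form_comm]

theorem quad_eq (x : V d) : quad x = ‖x.1‖ ^ 2 - ‖x.2‖ ^ 2 := by
  rw [quad, form_eq, real_inner_self_eq_norm_sq, real_inner_self_eq_norm_sq]

theorem quad_le (x : V d) : quad x ≤ ‖x.1‖ ^ 2 := by
  rw [quad_eq]; nlinarith [sq_nonneg ‖x.2‖]

theorem quad_smul (c : ℝ) (x : V d) : quad (c • x) = c ^ 2 * quad x := by
  rw [quad, form_smul_left, form_smul_right, quad]; ring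

theorem quad_smul_add_smul (a b : ℝ) (x y : V d) :
    quad (a • x + b • y) = a ^ 2 * quad x + 2 * a * b * form x y + b ^ 2 * quad y := by
  simp only [quad, form_add_left, form_add_right, form_smul_left, form_smul_right,
    form_comm y x]
  ring

theorem quad_sub (x y : V d) : quad (x - y) = quad x - 2 * form x y + quad y := by
  have := quad_smul_add_smul 1 (-1) x y
  simp only [one_smul, neg_smul, ← sub_eq_add_neg] at this
  rw [this]; ring

@[fun_prop]
theorem continuous_quad : Continuous (quad : V d → ℝ) := by
  have : (quad : V d → ℝ) = fun x => ‖x.1‖ ^ 2 - ‖x.2‖ ^ 2 := funext quad_eq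
  rw [this]; fun_prop

@[fun_prop]
theorem continuous_form_left (y : V d) : Continuous fun x => form x y := by
  simp_rw [form_eq]; fun_prop

theorem AdS.quad_eq (x : AdS d) : quad (x : V d) = -1 := x.2

theorem AdS.quad_sub (x y : AdS d) : quad ((x : V d) - (y : V d)) = -2 - 2 * form (x : V d) y := by
  rw [AdSGeometry.quad_sub, AdS.quad_eq x, AdS.quad_eq y]; ring

theorem AdS.norm_snd_sq (x : AdS d) : ‖(x : V d).2‖ ^ 2 = 1 + ‖(x : V d).1‖ ^ 2 := by
  have := AdS.quad_eq x
  rw [AdSGeometry.quad_eq] at this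
  linarith

/-- The projection of a map to `AdS^{d+1}` to the spacelike factor `ℝ^d`. -/
def shadow {H : Type*} (i : H → AdS d) (p : H) : E d := (i p : V d).1

theorem dist_shadow_le {H : Type*} (i : H → AdS d) (p q : H) :
    dist (shadow i p) (shadow i q) ≤ dist (i p) (i q) :=
  le_max_left _ _

/-- The negative definite factor can only lower `q`, so the spacelike inequality for `q(i x - i y)`
is inherited by the shadow. -/
theorem sqrt_mul_dist_le {H : Type*} [MetricSpace H] {i : H → AdS d} {x y : H} {c : ℝ} (hc : 0 < c)
    (h : form (i x : V d) (i y : V d) ≤ -1 - c * dist x y ^ 2) :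
    √(2 * c) * dist x y ≤ dist (shadow i x) (shadow i y) := by
  have h1 := quad_le ((i x : V d) - (i y : V d))
  rw [AdS.quad_sub] at h1
  refine abs_le_of_sq_le_sq' ?_ dist_nonneg |>.2
  rw [mul_pow, Real.sq_sqrt (by positivity), dist_eq_norm (shadow i x)]
  have : ((i x : V d) - (i y : V d)).1 = shadow i x - shadow i y := rfl
  rw [this] at h1
  linarith

variable {H : Type*} [MetricSpace H]

/-- A neighbourhood of a point on which a spacelike immersion is controlled by its shadow. -/
structure SpacelikeBox (i : H → AdS d) (p : H) where
  /-- The neighbourhood. -/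
  U : Set H
  /-- The radius of a ball covered by the shadow of the neighbourhood. -/
  r : ℝ
  /-- The lower bound for the length. -/
  κ : ℝ
  /-- The expansion constant. -/
  C : ℝ
  /-- The Lipschitz constant. -/
  K : NNReal
  /-- The inverse of the shadow. -/
  g : E d → H
  isOpen : IsOpen U
  mem : p ∈ U
  r_pos : 0 < r
  κ_pos : 0 < κ
  C_pos : 0 < C
  lipschitz : LipschitzOnWith K i U
  dist_le : ∀ x ∈ U, ∀ y ∈ U, dist x y ≤ C * dist (shadow i x) (shadow i y)
  le_quad : ∀ x ∈ U, ∀ y ∈ U,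
    κ ^ 2 * dist (shadow i x) (shadow i y) ^ 2 ≤ quad ((i x : V d) - (i y : V d))
  g_mem : ∀ y ∈ closedBall (shadow i p) r, g y ∈ U
  shadow_g : ∀ y ∈ closedBall (shadow i p) r, shadow i (g y) = y
  form_lt : ∀ x ∈ U, ∀ y ∈ U, x ≠ y → form (i x : V d) (i y) < -1

namespace IsSpacelikeImmersion

variable {i : H → AdS d} (hi : IsSpacelikeImmersion i)
include hi

theorem continuous : Continuous i := hi.1.continuous

theorem continuous_shadow : Continuous (shadow i) :=
  continuous_fst.comp (continuous_subtype_val.comp hi.continuous)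

theorem exists_nhds (p : H) : ∃ U : Set H, IsOpen U ∧ p ∈ U ∧ ∃ (K : NNReal) (c : ℝ), 0 < c ∧
    LipschitzOnWith K i U ∧ ∀ x ∈ U, ∀ y ∈ U,
      form (i x : V d) (i y : V d) ≤ -1 - c * dist x y ^ 2 := by
  obtain ⟨K, t, ht, hK⟩ := hi.1 p
  obtain ⟨s, hs, c, hc, hform⟩ := hi.2 p
  obtain ⟨U, hU, hUo, hpU⟩ := _root_.mem_nhds_iff.1 (inter_mem ht hs)
  exact ⟨U, hUo, hpU, K, c, hc, hK.mono fun x hx => (hU hx).1,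
    fun x hx y hy => hform x (hU hx).2 y (hU hy).2⟩

variable [ChartedSpace (E d) H] (hd : IsLipschitzDistance d H)
include hd

/-- Read in a chart, the shadow goes from `ℝ^d` to `ℝ^d`. It is Lipschitz because `i` is and expands
by `sqrt_mul_dist_le`, so bi-Lipschitz invariance of domain applies. -/
theorem isOpenMap_shadow : IsOpenMap (shadow i) := by
  rw [isOpenMap_iff_nhds_le]
  intro p W hW
  rw [mem_map] at hW
  obtain ⟨U, hUo, hpU, K, c, hc, hK, hform⟩ := hi.exists_nhds p
  set e := chartAt (E d) p
  have hpe : p ∈ e.source := mem_chart_source _ p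
  obtain ⟨U', hU', hU'e, C, hC, hbi⟩ := hd e (chart_mem_atlas _ p) p hpe
  have hN : shadow i ⁻¹' W ∩ (U ∩ U') ∈ 𝓝 p :=
    inter_mem hW (inter_mem (hUo.mem_nhds hpU) hU')
  have hN2 : e.target ∩ e.symm ⁻¹' (shadow i ⁻¹' W ∩ (U ∩ U')) ∈ 𝓝 (e p) := by
    refine inter_mem (e.open_target.mem_nhds (e.map_source hpe)) ?_
    apply e.symm.continuousAt (e.map_source hpe)
    rwa [e.left_inv hpe]
  obtain ⟨R, hR, hRsub⟩ := Metric.nhds_basis_closedBall.mem_iff.1 hN2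
  have h1 : ∀ x ∈ closedBall (e p) R, ∀ y ∈ closedBall (e p) R,
      dist (e.symm x) (e.symm y) ≤ C * dist x y ∧ dist x y ≤ C * dist (e.symm x) (e.symm y) := by
    intro x hx y hy
    have := hbi _ (hRsub hx).2.2.2 _ (hRsub hy).2.2.2
    rwa [e.right_inv (hRsub hx).1, e.right_inv (hRsub hy).1] at this
  have hLip : LipschitzOnWith (K * Real.toNNReal C) (shadow i ∘ e.symm) (closedBall (e p) R) := by
    refine LipschitzOnWith.of_dist_le_mul fun x hx y hy => ?_
    push_cast
    rw [Real.coe_toNNReal _ hC.le, mul_assoc]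
    refine ((dist_shadow_le i _ _).trans
      (hK.dist_le_mul _ (hRsub hx).2.2.1 _ (hRsub hy).2.2.1)).trans ?_
    gcongr
    exact (h1 x hx y hy).1
  have hanti : ∀ x ∈ closedBall (e p) R, ∀ y ∈ closedBall (e p) R,
      dist x y ≤ (C / √(2 * c)) * dist ((shadow i ∘ e.symm) x) ((shadow i ∘ e.symm) y) := by
    intro x hx y hy
    have h2 := sqrt_mul_dist_le hc (hform _ (hRsub hx).2.2.1 _ (hRsub hy).2.2.1)
    have hs : 0 < √(2 * c) := by positivity
    have h3 := (h1 x hx y hy).2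
    rw [div_mul_eq_mul_div, le_div_iff₀ hs]
    simp only [Function.comp_apply]
    calc dist x y * √(2 * c) ≤ C * dist (e.symm x) (e.symm y) * √(2 * c) := by gcongr
      _ = C * (√(2 * c) * dist (e.symm x) (e.symm y)) := by ring
      _ ≤ _ := by gcongr
  have := image_closedBall_mem_nhds_of_biLipschitz (by positivity) hR hLip hanti
  rw [Function.comp_apply, e.left_inv hpe] at this
  refine mem_of_superset this ?_
  rintro _ ⟨x, hx, rfl⟩
  exact (hRsub hx).2.1

theorem nonempty_box (p : H) : Nonempty (SpacelikeBox i p) := by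
  obtain ⟨U, hUo, hpU, K, c, hc, hK, hform⟩ := hi.exists_nhds p
  have himg : shadow i '' U ∈ 𝓝 (shadow i p) :=
    (hi.isOpenMap_shadow hd).image_mem_nhds (hUo.mem_nhds hpU)
  obtain ⟨r, hr, hsub⟩ := Metric.nhds_basis_closedBall.mem_iff.1 himg
  have hs : 0 < √(2 * c) := by positivity
  have : Nonempty H := ⟨p⟩
  exact ⟨{
    U := U
    r := r
    -- `q` of the difference is at least `2 c dist²`, while the shadow stretches distances by at
    -- most `K + 1`.
    κ := √(2 * c) / (K + 1)
    C := 1 / √(2 * c)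
    K := K
    g := Function.invFunOn (shadow i) U
    isOpen := hUo
    mem := hpU
    r_pos := hr
    κ_pos := by positivity
    C_pos := by positivity
    lipschitz := hK
    dist_le := fun x hx y hy => by
      rw [one_div, inv_mul_eq_div, le_div_iff₀ hs, mul_comm]
      exact sqrt_mul_dist_le hc (hform x hx y hy)
    le_quad := fun x hx y hy => by
      rw [AdS.quad_sub, div_pow, Real.sq_sqrt (by positivity)]
      have h1 := hform x hx y hy
      have h2 : dist (shadow i x) (shadow i y) ≤ (K + 1) * dist x y := by
        refine ((dist_shadow_le i _ _).trans (hK.dist_le_mul _ hx _ hy)).trans ?_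
        gcongr
        linarith
      have h3 : dist (shadow i x) (shadow i y) ^ 2 ≤ ((K + 1) * dist x y) ^ 2 := by gcongr
      rw [div_mul_eq_mul_div, div_le_iff₀ (by positivity)]
      have h4 : 2 * c * dist x y ^ 2 ≤ -2 - 2 * form (i x : V d) (i y) := by linarith
      calc 2 * c * dist (shadow i x) (shadow i y) ^ 2 ≤ 2 * c * ((K + 1) * dist x y) ^ 2 := by
            gcongr
        _ = 2 * c * dist x y ^ 2 * (K + 1) ^ 2 := by ring
        _ ≤ _ := by gcongr
    g_mem := fun y hy => Function.invFunOn_mem (hsub hy)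
    shadow_g := fun y hy => Function.invFunOn_eq (hsub hy)
    form_lt := fun x hx y hy hxy => by
      have := hform x hx y hy
      have : 0 < c * dist x y ^ 2 := mul_pos hc (pow_pos (dist_pos.2 hxy) 2)
      linarith }⟩

end IsSpacelikeImmersion

namespace SpacelikeBox

variable {i : H → AdS d} {p : H} (B : SpacelikeBox i p)
include B

theorem injOn : InjOn (shadow i) B.U := fun x hx y hy hxy => by
  have := B.dist_le x hx y hy
  rw [hxy, dist_self, mul_zero] at this
  exact dist_le_zero.1 this

theorem g_shadow {x : H} (hx : x ∈ B.U) (hxr : shadow i x ∈ closedBall (shadow i p) B.r) :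
    B.g (shadow i x) = x :=
  B.injOn (B.g_mem _ hxr) hx (B.shadow_g _ hxr)

theorem lipschitz_g : LipschitzOnWith (Real.toNNReal B.C) B.g (closedBall (shadow i p) B.r) := by
  refine LipschitzOnWith.of_dist_le_mul fun x hx y hy => ?_
  have := B.dist_le _ (B.g_mem x hx) _ (B.g_mem y hy)
  rwa [B.shadow_g x hx, B.shadow_g y hy, ← Real.coe_toNNReal _ B.C_pos.le] at this

end SpacelikeBox

theorem IsSpacelikeImmersion.isLocalHomeomorph_shadow {i : H → AdS d}
    [ChartedSpace (E d) H] (hi : IsSpacelikeImmersion i) (hd : IsLipschitzDistance d H) :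
    IsLocalHomeomorph (shadow i) := by
  rw [isLocalHomeomorph_iff_isOpenEmbedding_restrict]
  intro p
  obtain ⟨B⟩ := hi.nonempty_box hd p
  exact ⟨B.U, B.isOpen.mem_nhds B.mem, IsOpenEmbedding.of_continuous_injective_isOpenMap
    (hi.continuous_shadow.comp continuous_subtype_val) B.injOn.injective
    ((hi.isOpenMap_shadow hd).comp B.isOpen.isOpenMap_subtype_val)⟩

end

end AdSGeometry

/-! ### Lengths of paths and the pulled-back distance. -/

namespace AdSGeometry

noncomputable section

open MeasureTheory

variable {d : ℕ} {H : Type*}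

theorem pathLength_nonneg (i : H → AdS d) (γ : ℝ → H) : 0 ≤ pathLength i γ :=
  intervalIntegral.integral_nonneg zero_le_one fun _ _ => Real.sqrt_nonneg _

theorem pullbackDist_le [MetricSpace H] {i : H → AdS d} {γ : ℝ → H} {K : NNReal} (hγ : LipschitzOnWith K γ (Icc 0 1)) :
    pullbackDist i (γ 0) (γ 1) ≤ pathLength i γ :=
  csInf_le ⟨0, by rintro _ ⟨γ, -, -, -, rfl⟩; exact pathLength_nonneg i γ⟩
    ⟨γ, ⟨K, hγ⟩, rfl, rfl, rfl⟩

/-- The length of a path whose shadow is a segment is at most the length of the segment. -/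
theorem pathLength_le_norm {i : H → AdS d} {γ : ℝ → H} {x w : E d}
    (hγ : ∀ t ∈ Icc (0 : ℝ) 1, shadow i (γ t) = x + t • w) : pathLength i γ ≤ ‖w‖ := by
  have key : ‖∫ t in (0 : ℝ)..1, √(quad (deriv (fun s : ℝ => (i (γ s) : V d)) t))‖ ≤
      ‖w‖ * |1 - 0| := by
    apply intervalIntegral.norm_integral_le_of_norm_le_const_ae
    filter_upwards [Measure.ae_ne volume (1 : ℝ)] with t ht1 ht
    rw [uIoc_of_le zero_le_one] at ht
    have ht' : t ∈ Ioo (0 : ℝ) 1 := ⟨ht.1, lt_of_le_of_ne ht.2 ht1⟩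
    rw [Real.norm_of_nonneg (Real.sqrt_nonneg _)]
    -- Where the path is not differentiable, `deriv` is 0 and so is the integrand; no regularity of
    -- `γ` is needed for this upper bound.
    by_cases hdiff : DifferentiableAt ℝ (fun s : ℝ => (i (γ s) : V d)) t
    · have h1 : HasDerivAt (fun s : ℝ => (i (γ s) : V d).1)
          (deriv (fun s : ℝ => (i (γ s) : V d)) t).1 t :=
        (ContinuousLinearMap.fst ℝ (E d) (E 2)).hasFDerivAt.comp_hasDerivAt t hdiff.hasDerivAt
      have h2 : HasDerivAt (fun s : ℝ => x + s • w) w t := by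
        simpa using ((hasDerivAt_id t).smul_const w).const_add x
      have h3 : (fun s : ℝ => (i (γ s) : V d).1) =ᶠ[𝓝 t] fun s => x + s • w := by
        filter_upwards [Icc_mem_nhds ht'.1 ht'.2] with s hs using hγ s hs
      have h4 := h1.unique (h2.congr_of_eventuallyEq h3)
      refine (Real.sqrt_le_sqrt (quad_le _)).trans ?_
      rw [h4, Real.sqrt_sq (norm_nonneg _)]
    · rw [deriv_zero_of_not_differentiableAt hdiff, quad_eq]
      simp
  rw [pathLength]
  simpa using (le_abs_self _).trans key

variable [MetricSpace H] {i : H → AdS d}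

theorem IsSpacelikeImmersion.lipschitzOnWith_comp (hi : IsSpacelikeImmersion i) {γ : ℝ → H}
    {K : NNReal} (hγ : LipschitzOnWith K γ (Icc 0 1)) :
    ∃ M, LipschitzOnWith M (fun t => (i (γ t) : V d)) (Icc 0 1) := by
  apply LocallyLipschitzOn.exists_lipschitzOnWith_of_compact isCompact_Icc
  intro t ht
  obtain ⟨L, s, hs, hL⟩ := hi.1 (γ t)
  refine ⟨L * K, Icc 0 1 ∩ γ ⁻¹' s, inter_mem self_mem_nhdsWithin (hγ.continuousOn t ht hs), ?_⟩
  exact hL.comp (hγ.mono inter_subset_left) fun y hy => hy.2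

theorem norm_deriv_le_of_lipschitzOnWith_Icc {F : Type*} [NormedAddCommGroup F] [NormedSpace ℝ F]
    {φ : ℝ → F} {M : NNReal} (hφ : LipschitzOnWith M φ (Icc 0 1)) {t : ℝ} (ht : t ∈ Ioo (0 : ℝ) 1) :
    ‖deriv φ t‖ ≤ M :=
  norm_deriv_le_of_lipschitzOn (Icc_mem_nhds ht.1 ht.2) hφ

theorem sqrt_quad_le_norm (x : V d) : √(quad x) ≤ ‖x‖ := by
  refine (Real.sqrt_le_sqrt (quad_le x)).trans ?_
  rw [Real.sqrt_sq (norm_nonneg _)]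
  exact norm_fst_le x

theorem intervalIntegrable_sqrt_quad_deriv {φ : ℝ → V d} {M : NNReal}
    (hφ : LipschitzOnWith M φ (Icc 0 1)) :
    IntervalIntegrable (fun t => √(quad (deriv φ t))) volume 0 1 := by
  rw [intervalIntegrable_iff_integrableOn_Ioo_of_le zero_le_one]
  refine Measure.integrableOn_of_bounded (M := M) (by simp) ?_ ?_
  · exact (Real.continuous_sqrt.measurable.comp
      (continuous_quad.measurable.comp (measurable_deriv φ))).aestronglyMeasurable
  · rw [ae_restrict_iff' measurableSet_Ioo]
    refine ae_of_all _ fun t ht => ?_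
    rw [Real.norm_of_nonneg (Real.sqrt_nonneg _)]
    exact (sqrt_quad_le_norm _).trans (norm_deriv_le_of_lipschitzOnWith_Icc hφ ht)

namespace SpacelikeBox

variable {p : H} (B : SpacelikeBox i p)

/-- Infinitesimal form of `le_quad`: divide by `(s - t)²` and pass to the limit, `q` being
continuous and homogeneous of degree 2. -/
theorem mul_norm_deriv_le {γ : ℝ → H} {t : ℝ} {D : V d}
    (hD : HasDerivAt (fun s => (i (γ s) : V d)) D t) (hU : ∀ᶠ s in 𝓝 t, γ s ∈ B.U) :
    B.κ * ‖D.1‖ ≤ √(quad D) := by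
  apply Real.le_sqrt_of_sq_le
  rw [mul_pow]
  have hs := hasDerivAt_iff_tendsto_slope.1 hD
  have hc : Continuous fun x : V d => B.κ ^ 2 * ‖x.1‖ ^ 2 := by fun_prop
  refine le_of_tendsto_of_tendsto ((hc.tendsto D).comp hs) ((continuous_quad.tendsto D).comp hs) ?_
  filter_upwards [hU.filter_mono nhdsWithin_le_nhds] with s hsU
  have h := B.le_quad _ hsU _ hU.self_of_nhds
  simp only [Function.comp_apply, slope_def_module, quad_smul, Prod.smul_fst, norm_smul]
  rw [dist_eq_norm] at h
  have h2 : 0 ≤ ((s - t)⁻¹) ^ 2 := sq_nonneg _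
  calc B.κ ^ 2 * (‖(s - t)⁻¹‖ * ‖((i (γ s) : V d) - (i (γ t) : V d)).1‖) ^ 2
      = ((s - t)⁻¹) ^ 2 * (B.κ ^ 2 * ‖shadow i (γ s) - shadow i (γ t)‖ ^ 2) := by
        rw [mul_pow, Real.norm_eq_abs, sq_abs]
        simp only [shadow, Prod.fst_sub]
        ring
    _ ≤ _ := by gcongr

/-- In a box, the length of a path is bounded from below by the displacement of its shadow. -/
theorem mul_dist_le_pathLength (hi : IsSpacelikeImmersion i) {γ : ℝ → H} {K : NNReal}
    (hγ : LipschitzOnWith K γ (Icc 0 1)) {a b : ℝ} (ha : 0 ≤ a) (hab : a ≤ b) (hb : b ≤ 1)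
    (hU : ∀ t ∈ Icc a b, γ t ∈ B.U) :
    B.κ * dist (shadow i (γ a)) (shadow i (γ b)) ≤ pathLength i γ := by
  obtain ⟨M, hM⟩ := hi.lipschitzOnWith_comp hγ
  set φ : ℝ → V d := fun t => (i (γ t) : V d) with hφ
  have hsub : Icc a b ⊆ Icc 0 1 := Icc_subset_Icc ha hb
  have hint := intervalIntegrable_sqrt_quad_deriv hM
  have hint' : IntervalIntegrable (fun t => √(quad (deriv φ t))) volume a b :=
    hint.mono_set (by rwa [uIcc_of_le hab, uIcc_of_le zero_le_one])
  have hle : ∫ t in a..b, √(quad (deriv φ t)) ≤ pathLength i γ :=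
    intervalIntegral.integral_mono_interval ha hab hb
      (ae_of_all _ fun _ => Real.sqrt_nonneg _) hint
  refine le_trans ?_ hle
  -- the direction of the displacement
  set D : E d := shadow i (γ b) - shadow i (γ a) with hD
  -- If the displacement is zero, then so is `u`, and the two facts below still hold.
  set u : E d := ‖D‖⁻¹ • D
  have hu : ‖u‖ ≤ 1 := by
    rw [norm_smul, norm_inv, norm_norm]
    exact inv_mul_le_one
  have huD : inner ℝ D u = ‖D‖ := by
    rw [real_inner_smul_right, real_inner_self_eq_norm_sq]
    by_cases h : ‖D‖ = 0
    · simp [h]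
    · field_simp
  -- Pairing with `u` gives a scalar Lipschitz function, to which the fundamental theorem of
  -- calculus applies.
  set L : V d →L[ℝ] ℝ := (innerSL ℝ u).comp (ContinuousLinearMap.fst ℝ (E d) (E 2)) with hL
  have hLapp : ∀ x : V d, L x = inner ℝ u x.1 := fun x => rfl
  have hψ : LipschitzOnWith (‖L‖₊ * M) (fun t => L (φ t)) (uIcc a b) := by
    rw [uIcc_of_le hab]
    exact L.lipschitz.comp_lipschitzOnWith (hM.mono hsub)
  have hac := hψ.absolutelyContinuousOnInterval
  have hftc := hac.integral_deriv_eq_sub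
  have hdist : dist (shadow i (γ a)) (shadow i (γ b)) = L (φ b) - L (φ a) := by
    rw [← map_sub, hLapp, dist_comm, dist_eq_norm, ← hD, ← huD, real_inner_comm]
    rfl
  rw [hdist, ← hftc, ← intervalIntegral.integral_const_mul]
  refine intervalIntegral.integral_mono_ae_restrict hab
    (hac.intervalIntegrable_deriv.const_mul _) hint' ?_
  rw [← Measure.restrict_congr_set Ioo_ae_eq_Icc, EventuallyLE, ae_restrict_iff' measurableSet_Ioo]
  filter_upwards [hM.ae_differentiableWithinAt_of_mem_real] with t ht htab
  have ht01 : t ∈ Ioo (0 : ℝ) 1 := ⟨ha.trans_lt htab.1, htab.2.trans_le hb⟩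
  have hdiff : DifferentiableAt ℝ φ t :=
    (ht (Ioo_subset_Icc_self ht01)).differentiableAt (Icc_mem_nhds ht01.1 ht01.2)
  have hder : deriv (fun t => L (φ t)) t = L (deriv φ t) :=
    (L.hasFDerivAt.comp_hasDerivAt t hdiff.hasDerivAt).deriv
  have h1 := B.mul_norm_deriv_le hdiff.hasDerivAt
    (mem_of_superset (Icc_mem_nhds htab.1 htab.2) hU)
  rw [hder, hLapp]
  refine le_trans ?_ h1
  refine mul_le_mul_of_nonneg_left ?_ B.κ_pos.le
  refine (real_inner_le_norm _ _).trans ?_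
  exact mul_le_of_le_one_left (norm_nonneg _) hu

/-- A short path that ends at the centre of a box stays in the box. -/
theorem mem_of_pathLength_lt (hi : IsSpacelikeImmersion i) {γ : ℝ → H} {K : NNReal}
    (hγ : LipschitzOnWith K γ (Icc 0 1)) (h1 : γ 1 = p) (hlt : pathLength i γ < B.κ * B.r) :
    γ 0 ∈ B.U ∧ B.κ * dist (shadow i (γ 0)) (shadow i p) ≤ pathLength i γ := by
  set W : Set H := B.U ∩ shadow i ⁻¹' ball (shadow i p) B.r with hW
  have hWo : IsOpen W := B.isOpen.inter (isOpen_ball.preimage hi.continuous_shadow)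
  have hpW : p ∈ W := ⟨B.mem, mem_ball_self B.r_pos⟩
  -- The closure of `W` lies in a compact subset of the box, so a path can leave `W` only over the
  -- sphere of radius `r`.
  have hWcl : closure W ⊆ B.g '' closedBall (shadow i p) B.r := by
    refine closure_minimal ?_
      ((isCompact_closedBall _ _).image_of_continuousOn B.lipschitz_g.continuousOn).isClosed
    intro x hx
    exact ⟨shadow i x, ball_subset_closedBall hx.2,
      B.g_shadow hx.1 (ball_subset_closedBall hx.2)⟩
  have hall : ∀ t ∈ Icc (0 : ℝ) 1, γ t ∈ W := by
    by_contra! hcon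
    obtain ⟨t, ht, htW⟩ := hcon
    -- The path ends at the centre, so after its last time outside `W` it stays in the box and
    -- travels at least `r` in shadow, which costs length `κ r`.
    set S : Set ℝ := Icc 0 1 ∩ γ ⁻¹' Wᶜ with hS
    have hSc : IsCompact S :=
      isCompact_Icc.of_isClosed_subset
        (hγ.continuousOn.preimage_isClosed_of_isClosed isClosed_Icc hWo.isClosed_compl)
        inter_subset_left
    obtain ⟨t₀, ht₀, hmax⟩ := hSc.exists_isGreatest ⟨t, ht, htW⟩
    have ht₀1 : t₀ < 1 := by
      refine lt_of_le_of_ne ht₀.1.2 ?_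
      rintro rfl
      exact ht₀.2 (h1 ▸ hpW)
    have hafter : ∀ s ∈ Ioc t₀ 1, γ s ∈ W := by
      intro s hs
      by_contra hsW
      exact (hmax ⟨⟨ht₀.1.1.trans hs.1.le, hs.2⟩, hsW⟩).not_gt hs.1
    have hcl : γ t₀ ∈ closure W := by
      have hcont : ContinuousWithinAt γ (Ioc t₀ 1) t₀ :=
        (hγ.continuousOn t₀ ht₀.1).mono fun s hs => ⟨ht₀.1.1.trans hs.1.le, hs.2⟩
      refine hcont.mem_closure ?_ hafter
      rw [closure_Ioc ht₀1.ne]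
      exact left_mem_Icc.2 ht₀1.le
    obtain ⟨y, hy, hyt⟩ := hWcl hcl
    have htU : γ t₀ ∈ B.U := hyt ▸ B.g_mem y hy
    have hsh : shadow i (γ t₀) = y := by rw [← hyt, B.shadow_g y hy]
    have hr : B.r ≤ dist (shadow i (γ t₀)) (shadow i p) := by
      by_contra! h
      exact ht₀.2 ⟨htU, h⟩
    have := B.mul_dist_le_pathLength hi hγ ht₀.1.1 ht₀1.le le_rfl (fun s hs => by
      rcases hs.1.eq_or_lt with rfl | h
      · exact htU
      · exact (hafter s ⟨h, hs.2⟩).1)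
    rw [h1] at this
    have h3 := mul_le_mul_of_nonneg_left hr B.κ_pos.le
    linarith
  refine ⟨(hall 0 ⟨le_rfl, zero_le_one⟩).1, ?_⟩
  have := B.mul_dist_le_pathLength hi hγ le_rfl zero_le_one le_rfl fun t ht => (hall t ht).1
  rwa [h1] at this

end SpacelikeBox

/-- Two points joined by a Lipschitz path. -/
def LipschitzJoined (x y : H) : Prop :=
  ∃ γ : ℝ → H, (∃ K, LipschitzOnWith K γ (Icc 0 1)) ∧ γ 0 = x ∧ γ 1 = y

theorem LipschitzJoined.symm {x y : H} (h : LipschitzJoined x y) : LipschitzJoined y x := by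
  obtain ⟨γ, ⟨K, hK⟩, h0, h1⟩ := h
  refine ⟨fun t => γ (1 - t), ⟨K * 1, hK.comp (t := Icc 0 1)
    (LipschitzOnWith.of_dist_le_mul fun a _ b _ => ?_)
    fun t ht => ⟨by linarith [ht.2], by linarith [ht.1]⟩⟩, by simpa using h1, by simpa using h0⟩
  rw [Real.dist_eq, Real.dist_eq, show 1 - a - (1 - b) = -(a - b) by ring, abs_neg]
  simp

theorem LipschitzJoined.trans {x y z : H} (h : LipschitzJoined x y) (h' : LipschitzJoined y z) :
    LipschitzJoined x z := by
  obtain ⟨γ, ⟨K, hK⟩, h0, h1⟩ := h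
  obtain ⟨γ', ⟨K', hK'⟩, h0', h1'⟩ := h'
  -- Each half runs at double speed, so the concatenation is `2 M`-Lipschitz.
  set M : ℝ := max (K : ℝ) K' with hM
  set η : ℝ → H := fun t => if t ≤ 1 / 2 then γ (2 * t) else γ' (2 * t - 1) with hη
  have hη1 : ∀ t ∈ Icc (0 : ℝ) (1 / 2), η t = γ (2 * t) := fun t ht => if_pos ht.2
  have hη2 : ∀ t ∈ Icc (1 / 2 : ℝ) 1, η t = γ' (2 * t - 1) := by
    intro t ht
    rcases ht.1.eq_or_lt with rfl | h
    · simp [hη, h1, h0']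
    · exact if_neg (not_le.2 h)
  have a1 : ∀ s ∈ Icc (0 : ℝ) (1 / 2), ∀ t ∈ Icc (0 : ℝ) (1 / 2), s ≤ t →
      dist (η s) (η t) ≤ 2 * M * (t - s) := by
    intro s hs t ht hst
    rw [hη1 s hs, hη1 t ht]
    refine (hK.dist_le_mul _ ⟨by linarith [hs.1], by linarith [hs.2]⟩ _
      ⟨by linarith [ht.1], by linarith [ht.2]⟩).trans ?_
    rw [dist_comm, Real.dist_eq, abs_of_nonneg (by linarith)]
    nlinarith [le_max_left (K : ℝ) K']
  have a2 : ∀ s ∈ Icc (1 / 2 : ℝ) 1, ∀ t ∈ Icc (1 / 2 : ℝ) 1, s ≤ t →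
      dist (η s) (η t) ≤ 2 * M * (t - s) := by
    intro s hs t ht hst
    rw [hη2 s hs, hη2 t ht]
    refine (hK'.dist_le_mul _ ⟨by linarith [hs.1], by linarith [hs.2]⟩ _
      ⟨by linarith [ht.1], by linarith [ht.2]⟩).trans ?_
    rw [dist_comm, Real.dist_eq, abs_of_nonneg (by linarith)]
    nlinarith [le_max_right (K : ℝ) K']
  have a3 : ∀ s ∈ Icc (0 : ℝ) 1, ∀ t ∈ Icc (0 : ℝ) 1, s ≤ t →
      dist (η s) (η t) ≤ 2 * M * (t - s) := by
    intro s hs t ht hst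
    rcases le_total t (1 / 2) with h | h
    · exact a1 s ⟨hs.1, hst.trans h⟩ t ⟨ht.1, h⟩ hst
    rcases le_total (1 / 2) s with h' | h'
    · exact a2 s ⟨h', hs.2⟩ t ⟨h, ht.2⟩ hst
    refine (dist_triangle _ (η (1 / 2)) _).trans ?_
    have b1 := a1 s ⟨hs.1, h'⟩ (1 / 2) ⟨by norm_num, le_rfl⟩ h'
    have b2 := a2 (1 / 2) ⟨le_rfl, by norm_num⟩ t ⟨h, ht.2⟩ h
    linarith
  refine ⟨η, ⟨Real.toNNReal (2 * M), LipschitzOnWith.of_dist_le_mul fun s hs t ht => ?_⟩, ?_, ?_⟩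
  · rw [Real.coe_toNNReal _ (by positivity)]
    rcases le_total s t with h | h
    · rw [dist_comm s, Real.dist_eq, abs_of_nonneg (by linarith)]
      exact a3 s hs t ht h
    · rw [dist_comm, Real.dist_eq, abs_of_nonneg (by linarith)]
      exact a3 t ht s hs h
  · rw [hη1 0 ⟨le_rfl, by norm_num⟩]; simpa using h0
  · rw [hη2 1 ⟨by norm_num, le_rfl⟩]; norm_num [h1']

variable [ChartedSpace (E d) H]

/-- Nearby points are joined by lifting a segment through a box, and connectedness does the rest.
Without this the infimum defining `pullbackDist` might run over the empty set, where `sInf` is 0 and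
smallness would mean nothing. -/
theorem IsSpacelikeImmersion.lipschitzJoined [ConnectedSpace H] (hi : IsSpacelikeImmersion i)
    (hd : IsLipschitzDistance d H) (x y : H) : LipschitzJoined x y := by
  have : Std.Symm (LipschitzJoined (H := H)) := ⟨fun _ _ h => h.symm⟩
  refine PreconnectedSpace.induction₂ LipschitzJoined (fun p => ?_)
    ⟨fun _ _ _ h h' => h.trans h'⟩ x y
  obtain ⟨B⟩ := hi.nonempty_box hd p
  filter_upwards [B.isOpen.mem_nhds B.mem,
    hi.continuous_shadow.continuousAt (closedBall_mem_nhds (shadow i p) B.r_pos)] with q hqU hq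
  have hmem : ∀ t ∈ Icc (0 : ℝ) 1,
      AffineMap.lineMap (shadow i p) (shadow i q) t ∈ closedBall (shadow i p) B.r := fun t ht =>
    (convex_closedBall _ _).lineMap_mem (mem_closedBall_self B.r_pos.le) hq ht
  obtain ⟨L, hL⟩ : ∃ L, LipschitzWith L
      (AffineMap.lineMap (shadow i p) (shadow i q) : ℝ → E d) :=
    ⟨_, lipschitzWith_lineMap _ _⟩
  refine ⟨fun t => B.g (AffineMap.lineMap (shadow i p) (shadow i q) t),
    ⟨_, B.lipschitz_g.comp (hL.lipschitzOnWith (s := Icc 0 1)) hmem⟩, ?_, ?_⟩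
  · beta_reduce
    rw [AffineMap.lineMap_apply_zero]
    exact B.g_shadow B.mem (mem_closedBall_self B.r_pos.le)
  · beta_reduce
    rw [AffineMap.lineMap_apply_one]
    exact B.g_shadow hqU hq

/-- Convergence for the pulled-back distance implies convergence. -/
theorem IsSpacelikeImmersion.exists_dist_lt [ConnectedSpace H] (hi : IsSpacelikeImmersion i)
    (hd : IsLipschitzDistance d H) (p : H) {ε : ℝ} (hε : 0 < ε) :
    ∃ δ > 0, ∀ x, pullbackDist i x p < δ → dist x p < ε := by
  obtain ⟨B⟩ := hi.nonempty_box hd p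
  have hκ := B.κ_pos
  have hr := B.r_pos
  have hC := B.C_pos
  -- The first bound confines the path to the box; the second converts length into shadow
  -- displacement (`κ`) and then into distance (`C`).
  refine ⟨min (B.κ * B.r) (B.κ * ε / B.C), by positivity, fun x hx => ?_⟩
  obtain ⟨γ, ⟨K, hK⟩, h0, h1⟩ := hi.lipschitzJoined hd x p
  obtain ⟨_, ⟨γ, ⟨K, hK⟩, h0, h1, rfl⟩, hlt⟩ := exists_lt_of_csInf_lt
    (⟨_, γ, ⟨K, hK⟩, h0, h1, rfl⟩ : {L : ℝ | ∃ γ : ℝ → H, (∃ K, LipschitzOnWith K γ (Icc 0 1)) ∧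
      γ 0 = x ∧ γ 1 = p ∧ L = pathLength i γ}.Nonempty) hx
  obtain ⟨hU, hle⟩ := B.mem_of_pathLength_lt hi hK h1 (hlt.trans_le (min_le_left _ _))
  rw [h0] at hU hle
  have h2 := hlt.trans_le (min_le_right _ _)
  have h3 : B.κ * dist (shadow i x) (shadow i p) < B.κ * ε / B.C := hle.trans_lt h2
  rw [lt_div_iff₀ hC] at h3
  have h4 := B.dist_le x hU p B.mem
  have h5 : B.κ * dist x p < B.κ * ε := by
    refine lt_of_le_of_lt (mul_le_mul_of_nonneg_left h4 hκ.le) ?_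
    linarith
  exact lt_of_mul_lt_mul_left h5 hκ.le


end

end AdSGeometry

/-! ### Lifting segments: the shadow is a global homeomorphism. -/

namespace AdSGeometry

noncomputable section

variable {d : ℕ} {H : Type*} [MetricSpace H] {i : H → AdS d} [ChartedSpace (E d) H]

/-- A path in `H` over a straight segment of `ℝ^d`. -/
def IsSegmentLift (i : H → AdS d) (x w : E d) (γ : ℝ → H) (T : ℝ) : Prop :=
  ContinuousOn γ (Icc 0 T) ∧ ∀ t ∈ Icc (0 : ℝ) T, shadow i (γ t) = x + t • w

/-- Lifts are only required to be continuous, but lengths concern Lipschitz paths. In each box the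
inverse of the shadow is Lipschitz, and `[0, T]` is compact. -/
theorem IsSegmentLift.exists_lipschitzOnWith (hi : IsSpacelikeImmersion i)
    (hd : IsLipschitzDistance d H) {x w : E d} {γ : ℝ → H} {T : ℝ}
    (hγ : IsSegmentLift i x w γ T) : ∃ K, LipschitzOnWith K γ (Icc 0 T) := by
  apply LocallyLipschitzOn.exists_lipschitzOnWith_of_compact isCompact_Icc
  intro t ht
  obtain ⟨B⟩ := hi.nonempty_box hd (γ t)
  refine ⟨Real.toNNReal (B.C * ‖w‖), Icc 0 T ∩ γ ⁻¹' B.U,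
    inter_mem self_mem_nhdsWithin (hγ.1 t ht (B.isOpen.mem_nhds B.mem)), ?_⟩
  refine LipschitzOnWith.of_dist_le_mul fun s hs s' hs' => ?_
  have h := B.dist_le _ hs.2 _ hs'.2
  rw [hγ.2 s hs.1, hγ.2 s' hs'.1, dist_add_left, dist_eq_norm (s • w), ← sub_smul, norm_smul] at h
  rw [Real.coe_toNNReal _ (mul_nonneg B.C_pos.le (norm_nonneg _)), Real.dist_eq, ← Real.norm_eq_abs]
  linarith

theorem IsSegmentLift.pullbackDist_le (hi : IsSpacelikeImmersion i)
    (hd : IsLipschitzDistance d H) {x w : E d} {γ : ℝ → H} {T : ℝ}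
    (hγ : IsSegmentLift i x w γ T) {s t : ℝ} (hs : s ∈ Icc 0 T) (ht : t ∈ Icc 0 T) :
    pullbackDist i (γ s) (γ t) ≤ |t - s| * ‖w‖ := by
  obtain ⟨K, hK⟩ := hγ.exists_lipschitzOnWith hi hd
  obtain ⟨L, hL⟩ : ∃ L, LipschitzWith L (AffineMap.lineMap s t : ℝ → ℝ) :=
    ⟨_, lipschitzWith_lineMap _ _⟩
  have hmaps : MapsTo (AffineMap.lineMap s t : ℝ → ℝ) (Icc 0 1) (Icc 0 T) := fun τ hτ =>
    (convex_Icc 0 T).lineMap_mem hs ht hτ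
  have h1 := AdSGeometry.pullbackDist_le (i := i) (hK.comp (hL.lipschitzOnWith (s := Icc 0 1)) hmaps)
  have h2 : pathLength i (γ ∘ (AffineMap.lineMap s t : ℝ → ℝ)) ≤ ‖(t - s) • w‖ := by
    refine pathLength_le_norm (x := x + s • w) fun τ hτ => ?_
    rw [Function.comp_apply, hγ.2 _ (hmaps hτ), AffineMap.lineMap_apply_ring']
    module
  simp only [Function.comp_apply, AffineMap.lineMap_apply_zero, AffineMap.lineMap_apply_one] at h1
  rw [norm_smul, Real.norm_eq_abs] at h2
  exact h1.trans h2

theorem IsSegmentLift.eqOn (hi : IsSpacelikeImmersion i) (hd : IsLipschitzDistance d H)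
    {x w : E d} {γ γ' : ℝ → H} {T T' : ℝ} (hγ : IsSegmentLift i x w γ T)
    (hγ' : IsSegmentLift i x w γ' T') (h0 : γ 0 = γ' 0) (hT : 0 ≤ T) (hTT' : T ≤ T') :
    EqOn γ γ' (Icc 0 T) := by
  have hsub : Icc 0 T ⊆ Icc 0 T' := Icc_subset_Icc_right hTT'
  refine (T2Space.isSeparatedMap (shadow i)).eqOn_of_comp_eqOn
    (hi.isLocalHomeomorph_shadow hd).isLocallyInjective isPreconnected_Icc hγ.1
    (hγ'.1.mono hsub) (fun t ht => ?_) (left_mem_Icc.2 hT) h0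
  simp only [Function.comp_apply]
  rw [hγ.2 t ht, hγ'.2 t (hsub ht)]

/-- Completeness allows one to lift segments. -/
theorem IsCompleteSpacelikeImmersion.exists_isSegmentLift [ConnectedSpace H]
    (hc : IsCompleteSpacelikeImmersion i) (hd : IsLipschitzDistance d H) (p₀ : H) (w : E d) :
    ∃ γ : ℝ → H, IsSegmentLift i (shadow i p₀) w γ 1 ∧ γ 0 = p₀ := by
  have hi := hc.1
  set x := shadow i p₀ with hx
  -- Times up to which a lift exists. Endpoints of lifts with times tending to the supremum are
  -- Cauchy for the pulled-back distance, so they converge by completeness, and a box at the limit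
  -- continues the lift.
  set S : Set ℝ := {T | T ∈ Icc (0 : ℝ) 1 ∧ ∃ γ, IsSegmentLift i x w γ T ∧ γ 0 = p₀} with hS
  have hS0 : (0 : ℝ) ∈ S := by
    refine ⟨⟨le_rfl, zero_le_one⟩, fun _ => p₀, ⟨continuousOn_const, fun t ht => ?_⟩, rfl⟩
    rw [Icc_self, mem_singleton_iff] at ht
    rw [ht, zero_smul, add_zero]
  have hSb : BddAbove S := ⟨1, fun T hT => hT.1.2⟩
  obtain ⟨T, hTmono, hTlim, hTS⟩ := exists_seq_tendsto_sSup ⟨0, hS0⟩ hSb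
  set Ts := sSup S with hTs
  choose γ hγ hγ0 using fun n => (hTS n).2
  have hT0 : ∀ n, 0 ≤ T n := fun n => (hTS n).1.1
  have hcomp : ∀ m n, m ≤ n → γ m (T m) = γ n (T m) := fun m n hmn =>
    (hγ m).eqOn hi hd (hγ n) ((hγ0 m).trans (hγ0 n).symm) (hT0 m) (hTmono hmn)
      (right_mem_Icc.2 (hT0 m))
  have hdist : ∀ m n, pullbackDist i (γ m (T m)) (γ n (T n)) ≤ |T n - T m| * ‖w‖ := by
    intro m n
    rcases le_total m n with h | h
    · rw [hcomp m n h]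
      exact (hγ n).pullbackDist_le hi hd ⟨hT0 m, hTmono h⟩ (right_mem_Icc.2 (hT0 n))
    · rw [hcomp n m h]
      exact (hγ m).pullbackDist_le hi hd (right_mem_Icc.2 (hT0 m)) ⟨hT0 n, hTmono h⟩
  obtain ⟨p, hp⟩ := hc.2 (fun n => γ n (T n)) (by
    intro ε hε
    obtain ⟨N, hN⟩ := Metric.cauchySeq_iff.1 hTlim.cauchySeq (ε / (‖w‖ + 1)) (by positivity)
    refine ⟨N, fun m hm n hn => (hdist m n).trans_lt ?_⟩
    have h1 := hN n hn m hm
    rw [Real.dist_eq, lt_div_iff₀ (by positivity)] at h1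
    nlinarith [abs_nonneg (T n - T m)])
  have hlim : Tendsto (fun n => γ n (T n)) atTop (𝓝 p) := by
    rw [Metric.tendsto_atTop']
    intro ε hε
    obtain ⟨δ, hδ, h⟩ := hi.exists_dist_lt hd p hε
    obtain ⟨N, hN⟩ := (Metric.tendsto_atTop.1 hp) δ hδ
    refine ⟨N, fun n hn => h _ ?_⟩
    have := hN n hn.le
    rw [Real.dist_eq, sub_zero] at this
    exact (le_abs_self _).trans_lt this
  have hpx : shadow i p = x + Ts • w := by
    refine tendsto_nhds_unique ((hi.continuous_shadow.tendsto p).comp hlim) ?_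
    have : Tendsto (fun n => x + T n • w) atTop (𝓝 (x + Ts • w)) :=
      (hTlim.smul_const w).const_add x
    refine this.congr fun n => ?_
    rw [Function.comp_apply, (hγ n).2 _ (right_mem_Icc.2 (hT0 n))]
  obtain ⟨B⟩ := hi.nonempty_box hd p
  have hcont : Continuous fun t : ℝ => x + t • w := by fun_prop
  have hnear : ∀ᶠ t in 𝓝 Ts, x + t • w ∈ closedBall (shadow i p) B.r := by
    apply hcont.continuousAt
    beta_reduce
    rw [← hpx]
    exact closedBall_mem_nhds _ B.r_pos
  obtain ⟨η, hη, hηsub⟩ := Metric.eventually_nhds_iff.1 hnear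
  obtain ⟨n, hnU, hnη⟩ := ((hlim.eventually (B.isOpen.mem_nhds B.mem)).and
    (hTlim.eventually (Metric.ball_mem_nhds Ts hη))).exists
  have hTn : T n ≤ Ts := le_csSup hSb (hTS n)
  change dist (T n) Ts < η at hnη
  rw [Real.dist_eq, abs_sub_lt_iff] at hnη
  have hseg : ∀ t ∈ Icc (T n) (Ts + η / 2), x + t • w ∈ closedBall (shadow i p) B.r := by
    intro t ht
    apply hηsub
    rw [Real.dist_eq, abs_sub_lt_iff]
    constructor <;> linarith [ht.1, ht.2]
  -- Either this is 1, or it exceeds the supremum of `S`, a contradiction.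
  set T' := min 1 (Ts + η / 2) with hT'
  have hTnT' : T n ≤ T' := le_min (hTS n).1.2 (by linarith)
  have hT'S : T' ∈ S := by
    refine ⟨⟨(hT0 n).trans hTnT', min_le_left _ _⟩,
      fun t => if t ≤ T n then γ n t else B.g (x + t • w), ⟨?_, ?_⟩, ?_⟩
    · rw [← Icc_union_Icc_eq_Icc (hT0 n) hTnT']
      have c1 : ContinuousOn (fun t => if t ≤ T n then γ n t else B.g (x + t • w))
          (Icc 0 (T n)) := (hγ n).1.congr fun t ht => if_pos ht.2
      have c2 : ContinuousOn (fun t => if t ≤ T n then γ n t else B.g (x + t • w))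
          (Icc (T n) T') := by
        have : ContinuousOn (fun t : ℝ => B.g (x + t • w)) (Icc (T n) T') :=
          B.lipschitz_g.continuousOn.comp hcont.continuousOn
            fun t ht => hseg t ⟨ht.1, ht.2.trans (min_le_right _ _)⟩
        refine this.congr fun t ht => ?_
        beta_reduce
        split_ifs with h
        · obtain rfl : t = T n := le_antisymm h ht.1
          have h2 := (hγ n).2 _ (right_mem_Icc.2 (hT0 n))
          rw [← h2]
          refine (B.g_shadow hnU ?_).symm
          rw [h2]
          exact hseg _ ⟨le_rfl, by linarith⟩
        · rfl
      exact c1.union_of_isClosed c2 isClosed_Icc isClosed_Icc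
    · intro t ht
      beta_reduce
      split_ifs with h
      · exact (hγ n).2 t ⟨ht.1, h⟩
      · exact B.shadow_g _ (hseg t ⟨(not_le.1 h).le, ht.2.trans (min_le_right _ _)⟩)
    · beta_reduce
      rw [if_pos (hT0 n), hγ0]
  have h1 : T' ≤ Ts := le_csSup hSb hT'S
  have h2 : T' = 1 := by
    rcases min_choice 1 (Ts + η / 2) with h | h
    · exact h
    · rw [hT', h] at h1; linarith
  rw [h2] at hT'S
  exact hT'S.2

/-- The shadow of a complete spacelike immersion is a homeomorphism. -/
theorem IsCompleteSpacelikeImmersion.isHomeomorph_shadow [ConnectedSpace H]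
    (hc : IsCompleteSpacelikeImmersion i) (hd : IsLipschitzDistance d H) :
    IsHomeomorph (shadow i) := by
  have hi := hc.1
  have hloc := hi.isLocalHomeomorph_shadow hd
  have hsep := T2Space.isSeparatedMap (shadow i)
  obtain ⟨p₀⟩ : Nonempty H := inferInstance
  -- The lifts of all segments from one base point depend continuously on the segment; their
  -- endpoints form a continuous section `s` of the shadow.
  choose γ hγ hγ0 using fun w => hc.exists_isSegmentLift hd p₀ w
  let f : C(unitInterval × E d, E d) :=
    ⟨fun a => shadow i p₀ + (a.1 : ℝ) • a.2, by fun_prop⟩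
  have hcl : Continuous fun a : unitInterval × E d => γ a.2 a.1 := by
    refine hloc.continuous_lift hsep f ?_ ?_ fun w => ?_
    · ext1 a
      exact (hγ a.2).2 a.1 a.1.2
    · simp [hγ0, continuous_const]
    · exact (hγ w).1.comp_continuous continuous_subtype_val fun t => t.2
  let s : E d → H := fun y => γ (y - shadow i p₀) 1
  have hs : Continuous s :=
    hcl.comp (f := fun y : E d => ((1 : unitInterval), y - shadow i p₀)) (by fun_prop)
  have hfs : ∀ y, shadow i (s y) = y := fun y => by
    rw [(hγ _).2 1 (right_mem_Icc.2 zero_le_one), one_smul, add_sub_cancel]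
  -- The range of a section is closed because `H` is Hausdorff, and open because a section of a
  -- local homeomorphism is a local homeomorphism; `H` is connected.
  have hrange : range s = univ := by
    have hclosed : IsClosed (range s) := by
      have : range s = {p | s (shadow i p) = p} := by
        ext p
        constructor
        · rintro ⟨y, rfl⟩
          change s (shadow i (s y)) = s y
          rw [hfs]
        · exact fun h => ⟨_, h⟩
      rw [this]
      exact isClosed_eq (hs.comp hi.continuous_shadow) continuous_id
    have hopen : IsOpen (range s) := by
      have : IsLocalHomeomorph (shadow i ∘ s) := by
        have : shadow i ∘ s = id := funext hfs
        rw [this]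
        exact (Homeomorph.refl _).isLocalHomeomorph
      exact (this.of_comp hloc hs).isOpenMap.isOpen_range
    exact IsClopen.eq_univ ⟨hclosed, hopen⟩ (range_nonempty s)
  have hsf : ∀ p, s (shadow i p) = p := by
    intro p
    obtain ⟨y, rfl⟩ := (hrange ▸ mem_univ p : p ∈ range s)
    rw [hfs]
  exact ⟨hi.continuous_shadow, hloc.isOpenMap, Function.LeftInverse.injective hsf,
    Function.RightInverse.surjective hfs⟩

theorem IsCompleteSpacelikeImmersion.isEmbedding [ConnectedSpace H]
    (hc : IsCompleteSpacelikeImmersion i) (hd : IsLipschitzDistance d H) : IsEmbedding i :=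
  IsEmbedding.of_comp hc.1.continuous (g := fun x : AdS d => (x : V d).1) (by fun_prop)
    (hc.isHomeomorph_shadow hd).isEmbedding

end

end AdSGeometry

/-! ### Angle comparison and the global spacelike inequality. -/

namespace AdSGeometry

noncomputable section

section Angle

open InnerProductGeometry

variable {F F' : Type*} [NormedAddCommGroup F] [InnerProductSpace ℝ F]
  [NormedAddCommGroup F'] [InnerProductSpace ℝ F']

theorem inner_div_norm_mem_Icc (x y : F) :
    inner ℝ x y / (‖x‖ * ‖y‖) ∈ Icc (-1 : ℝ) 1 :=
  abs_le.1 (abs_real_inner_div_norm_mul_norm_le_one x y)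

theorem angle_lt_angle_iff {x y : F} {x' y' : F'} (hx : x ≠ 0) (hy : y ≠ 0) (hxx : ‖x‖ = ‖x'‖)
    (hyy : ‖y‖ = ‖y'‖) : angle x y < angle x' y' ↔ inner ℝ x' y' < inner ℝ x y := by
  have h : 0 < ‖x'‖ * ‖y'‖ := by
    rw [← hxx, ← hyy]; exact mul_pos (norm_pos_iff.2 hx) (norm_pos_iff.2 hy)
  rw [angle, angle, Real.strictAntiOn_arccos.lt_iff_gt (inner_div_norm_mem_Icc x y)
    (inner_div_norm_mem_Icc x' y'), hxx, hyy, div_lt_div_iff_of_pos_right h]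

/-- A line avoiding the origin is seen from it as an arc of a great circle of length at most `π`. -/
theorem angle_lineMap_add_angle_lineMap {x y : F} (h0 : ∀ t : ℝ, AffineMap.lineMap x y t ≠ (0 : F))
    {s t : ℝ} (hs : 0 ≤ s) (hst : s ≤ t) :
    angle x (AffineMap.lineMap x y s) + angle (AffineMap.lineMap x y s) (AffineMap.lineMap x y t) =
      angle x (AffineMap.lineMap x y t) := by
  have hx : x ≠ 0 := by simpa using h0 0
  have hw : Wbtw ℝ x (AffineMap.lineMap x y s) (AffineMap.lineMap x y t) := by
    rcases hs.eq_or_lt with rfl | hs'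
    · simp
    have ht : 0 < t := hs'.trans_le hst
    refine ⟨s / t, ⟨by positivity, (div_le_one ht).2 hst⟩, ?_⟩
    simp only [AffineMap.lineMap_apply_module']
    rw [add_sub_cancel_right, smul_smul, div_mul_cancel₀ _ ht.ne']
  have := EuclideanGeometry.angle_add_of_ne_of_ne (Ne.symm hx) (h0 t).symm hw
  simpa [EuclideanGeometry.angle] using this

variable {X : Type*} [NormedAddCommGroup X] [NormedSpace ℝ X]

/-- A map that locally does not increase angles does not increase angles along segments. -/
theorem angle_le_angle_of_local {Z : X → F} {W : X →ᵃ[ℝ] F'} (hZ : Continuous Z)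
    (hWc : Continuous W) (hZ0 : ∀ x, Z x ≠ 0) (hW0 : ∀ x, W x ≠ 0)
    (hloc : ∀ x, ∃ N ∈ 𝓝 x, ∀ y ∈ N, ∀ y' ∈ N, y ≠ y' → angle (Z y) (Z y') < angle (W y) (W y'))
    (x y : X) : angle (Z x) (Z y) ≤ angle (W x) (W y) := by
  set L : ℝ → X := fun t => AffineMap.lineMap x y t with hL
  have hLc : Continuous L := AffineMap.lineMap_continuous
  have hWL : ∀ t, W (L t) = AffineMap.lineMap (W x) (W y) t := fun t => W.apply_lineMap x y t
  set S : Set ℝ := {t | angle (Z x) (Z (L t)) ≤ angle (W x) (W (L t))} with hS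
  have hZLc : Continuous fun t => angle (Z x) (Z (L t)) := continuous_iff_continuousAt.2 fun t =>
    (continuousAt_angle (x := (Z x, Z (L t))) (hZ0 _) (hZ0 _)).comp
      (f := fun t => (Z x, Z (L t))) (by fun_prop)
  have hWLc : Continuous fun t => angle (W x) (W (L t)) := continuous_iff_continuousAt.2 fun t =>
    (continuousAt_angle (x := (W x, W (L t))) (hW0 _) (hW0 _)).comp
      (f := fun t => (W x, W (L t))) (by fun_prop)
  -- Continuous induction: a short step adds angles exactly on the `W` side and at most adds them,
  -- by the triangle inequality, on the `Z` side.
  have hsub : Icc 0 1 ⊆ S := by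
    apply IsClosed.Icc_subset_of_forall_exists_gt
    · exact (isClosed_le hZLc hWLc).inter isClosed_Icc
    · simp [hS, hL, angle_self (hZ0 x), angle_nonneg]
    · rintro t ⟨htS, ht⟩ u hu
      rcases eq_or_ne x y with rfl | hxy
      · exact ⟨u, by simp [hS, hL, angle_self (hZ0 x), angle_nonneg], hu, le_rfl⟩
      obtain ⟨N, hN, hNa⟩ := hloc (L t)
      have hev : ∀ᶠ s in 𝓝[>] t, L s ∈ N ∧ s ∈ Ioc t u :=
        (Filter.Eventually.filter_mono nhdsWithin_le_nhds
          (show ∀ᶠ s in 𝓝 t, L s ∈ N from hLc.continuousAt hN)).and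
          (Ioc_mem_nhdsGT hu)
      obtain ⟨s, hsN, hs⟩ := hev.exists
      refine ⟨s, ?_, hs⟩
      have hne : L t ≠ L s := fun h => hs.1.ne (AffineMap.lineMap_injective ℝ hxy h)
      have h1 := hNa _ (mem_of_mem_nhds hN) _ hsN hne
      have h2 := angle_lineMap_add_angle_lineMap (x := W x) (y := W y)
        (fun τ => by rw [← hWL]; exact hW0 _) ht.1 hs.1.le
      rw [← hWL, ← hWL] at h2
      have h3 := angle_le_angle_add_angle (Z x) (Z (L t)) (Z (L s))
      have h4 : angle (Z x) (Z (L t)) ≤ angle (W x) (W (L t)) := htS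
      change angle (Z x) (Z (L s)) ≤ angle (W x) (W (L s))
      linarith
  have := hsub (right_mem_Icc.2 zero_le_one)
  simpa [hS, hL] using this

/-- Strictness is gained on a short initial piece; the weak inequality handles the remainder. -/
theorem angle_lt_angle_of_local {Z : X → F} {W : X →ᵃ[ℝ] F'} (hZ : Continuous Z)
    (hWc : Continuous W) (hZ0 : ∀ x, Z x ≠ 0) (hW0 : ∀ x, W x ≠ 0)
    (hloc : ∀ x, ∃ N ∈ 𝓝 x, ∀ y ∈ N, ∀ y' ∈ N, y ≠ y' → angle (Z y) (Z y') < angle (W y) (W y'))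
    {x y : X} (hxy : x ≠ y) : angle (Z x) (Z y) < angle (W x) (W y) := by
  set L : ℝ → X := fun t => AffineMap.lineMap x y t with hL
  have hLc : Continuous L := AffineMap.lineMap_continuous
  have hWL : ∀ t, W (L t) = AffineMap.lineMap (W x) (W y) t := fun t => W.apply_lineMap x y t
  obtain ⟨N, hN, hNa⟩ := hloc x
  have hN' : N ∈ 𝓝 (L 0) := by simpa [hL] using hN
  have hev : ∀ᶠ s in 𝓝[>] (0 : ℝ), L s ∈ N ∧ s ∈ Ioc (0 : ℝ) 1 :=
    (Filter.Eventually.filter_mono nhdsWithin_le_nhds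
      (show ∀ᶠ s in 𝓝 0, L s ∈ N from hLc.continuousAt hN')).and
      (Ioc_mem_nhdsGT one_pos)
  obtain ⟨s, hsN, hs⟩ := hev.exists
  have hne : x ≠ L s := fun h => hs.1.ne (AffineMap.lineMap_injective ℝ hxy (by simpa [hL] using h))
  have h1 := hNa _ (mem_of_mem_nhds hN) _ hsN hne
  have h2 := angle_lineMap_add_angle_lineMap (x := W x) (y := W y)
    (fun τ => by rw [← hWL]; exact hW0 _) hs.1.le hs.2
  rw [← hWL, AffineMap.lineMap_apply_one] at h2
  have h3 := angle_le_angle_add_angle (Z x) (Z (L s)) (Z y)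
  have h4 := angle_le_angle_of_local hZ hWc hZ0 hW0 hloc (L s) y
  linarith

end Angle

variable {d : ℕ}

theorem AdS.snd_ne_zero (x : AdS d) : (x : V d).2 ≠ 0 := by
  intro h
  have := AdS.norm_snd_sq x
  rw [h, norm_zero] at this
  nlinarith [sq_nonneg ‖(x : V d).1‖]

/-- The map `x ↦ (x, 1)`, that identifies `ℝ^d` with the open hemisphere up to normalization. -/
def hemisphereLift (d : ℕ) : E d →ᵃ[ℝ] WithLp 2 (E d × ℝ) :=
  ((WithLp.linearEquiv 2 ℝ (E d × ℝ)).symm : E d × ℝ →ₗ[ℝ] WithLp 2 (E d × ℝ)).toAffineMap.comp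
    ((AffineMap.id ℝ (E d)).prod (AffineMap.const ℝ (E d) (1 : ℝ)))

theorem hemisphereLift_apply (x : E d) : hemisphereLift d x = WithLp.toLp 2 (x, (1 : ℝ)) := rfl

theorem inner_hemisphereLift (x y : E d) :
    inner ℝ (hemisphereLift d x) (hemisphereLift d y) = inner ℝ x y + 1 := by
  simp [hemisphereLift_apply, WithLp.prod_inner_apply]

theorem continuous_hemisphereLift : Continuous (hemisphereLift d) := by
  have : (hemisphereLift d : E d → _) = fun x => WithLp.toLp 2 (x, (1 : ℝ)) := rfl
  rw [this]
  fun_prop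

theorem hemisphereLift_ne_zero (x : E d) : hemisphereLift d x ≠ 0 := by
  intro h
  have := inner_hemisphereLift x x
  rw [h, inner_zero_left, real_inner_self_eq_norm_sq] at this
  nlinarith [sq_nonneg ‖x‖]

theorem AdS.norm_snd_eq (x : AdS d) : ‖(x : V d).2‖ = ‖hemisphereLift d (x : V d).1‖ := by
  have h := inner_hemisphereLift (x : V d).1 (x : V d).1
  rw [real_inner_self_eq_norm_sq, real_inner_self_eq_norm_sq] at h
  rw [← abs_of_nonneg (norm_nonneg (x : V d).2),
    ← abs_of_nonneg (norm_nonneg (hemisphereLift d (x : V d).1)), ← sq_eq_sq_iff_abs_eq_abs,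
    AdS.norm_snd_sq, h, add_comm]

/-- On the quadric the second factor `y` and the lift `(x, 1)` have equal norms, so comparing angles
amounts to comparing inner products. -/
theorem AdS.angle_lt_angle_iff (x y : AdS d) :
    InnerProductGeometry.angle (x : V d).2 (y : V d).2 <
      InnerProductGeometry.angle (hemisphereLift d (x : V d).1) (hemisphereLift d (y : V d).1) ↔
    form (x : V d) (y : V d) < -1 := by
  rw [AdSGeometry.angle_lt_angle_iff (AdS.snd_ne_zero x) (AdS.snd_ne_zero y) (AdS.norm_snd_eq x)
    (AdS.norm_snd_eq y), inner_hemisphereLift, form_eq]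
  constructor <;> intro h <;> linarith

variable {H : Type*} [MetricSpace H] {i : H → AdS d} [ChartedSpace (E d) H]

/-- With the shadow as a global coordinate, the inequality within boxes is a local strict
contraction of angles, which propagates along segments of `ℝ^d`. -/
theorem IsCompleteSpacelikeImmersion.form_lt [ConnectedSpace H]
    (hc : IsCompleteSpacelikeImmersion i) (hd : IsLipschitzDistance d H) {p q : H} (hpq : p ≠ q) :
    form (i p : V d) (i q : V d) < -1 := by
  let f : H ≃ₜ E d := (hc.isHomeomorph_shadow hd).homeomorph
  have hf : ∀ p, f p = (i p : V d).1 := fun p => rfl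
  have hfs : ∀ x, (i (f.symm x) : V d).1 = x := fun x => by rw [← hf, f.apply_symm_apply]
  have key := angle_lt_angle_of_local (Z := fun x => (i (f.symm x) : V d).2)
    (W := hemisphereLift d)
    (continuous_snd.comp (continuous_subtype_val.comp (hc.1.continuous.comp f.symm.continuous)))
    continuous_hemisphereLift (fun x => AdS.snd_ne_zero _) hemisphereLift_ne_zero
    (fun x => by
      obtain ⟨B⟩ := hc.1.nonempty_box hd (f.symm x)
      refine ⟨f.symm ⁻¹' B.U,
        f.symm.continuous.continuousAt (B.isOpen.mem_nhds B.mem), fun y hy y' hy' hyy' => ?_⟩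
      have := (AdS.angle_lt_angle_iff _ _).2
        (B.form_lt _ hy _ hy' (f.symm.injective.ne hyy'))
      rwa [hfs, hfs] at this)
    (f.injective.ne hpq)
  beta_reduce at key
  rw [f.symm_apply_apply, f.symm_apply_apply, hf, hf] at key
  exact (AdS.angle_lt_angle_iff _ _).1 key

/-- Two points of a linear section of `AdS^{d+1}` with negative product are joined in it. -/
theorem mem_connectedComponentIn_of_form_neg (P : Submodule ℝ (V d)) {x y : V d}
    (hx : x ∈ (P : Set (V d)) ∩ AdS d) (hy : y ∈ (P : Set (V d)) ∩ AdS d) (h : form x y < 0) :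
    y ∈ connectedComponentIn ((P : Set (V d)) ∩ AdS d) x := by
  have hxq : quad x = -1 := hx.2
  have hyq : quad y = -1 := hy.2
  set c : ℝ → V d := fun t => (1 - t) • x + t • y with hc
  have hq : ∀ t ∈ Icc (0 : ℝ) 1, quad (c t) < 0 := by
    intro t ht
    simp only [hc]
    rw [quad_smul_add_smul, hxq, hyq]
    have : (1 - t) * t * form x y ≤ 0 :=
      mul_nonpos_of_nonneg_of_nonpos (mul_nonneg (by linarith [ht.2]) ht.1) h.le
    nlinarith [sq_nonneg (1 - 2 * t)]
  -- The segment stays in `q < 0`, so it can be rescaled onto the quadric inside `P`.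
  set n : ℝ → V d := fun t => (√(-quad (c t)))⁻¹ • c t with hn
  have hnc : ContinuousOn n (Icc 0 1) := by
    have hcc : Continuous c := by fun_prop
    refine ContinuousOn.smul (ContinuousOn.inv₀
      (continuous_quad.comp hcc).neg.sqrt.continuousOn fun t ht => ?_) hcc.continuousOn
    exact (Real.sqrt_pos.2 (show 0 < -quad (c t) by linarith [hq t ht])).ne'
  have hsub : n '' Icc 0 1 ⊆ (P : Set (V d)) ∩ AdS d := by
    rintro _ ⟨t, ht, rfl⟩
    refine ⟨P.smul_mem _ (P.add_mem (P.smul_mem _ hx.1) (P.smul_mem _ hy.1)), ?_⟩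
    change quad (n t) = -1
    have := hq t ht
    simp only [hn]
    rw [quad_smul, inv_pow, Real.sq_sqrt (by linarith)]
    rw [inv_mul_eq_div, div_eq_iff (by linarith)]
    ring
  have hn0 : n 0 = x := by simp [hn, hc, hxq]
  have hn1 : n 1 = y := by simp [hn, hc, hyq]
  exact (isPreconnected_Icc.image n hnc).subset_connectedComponentIn
    ⟨0, left_mem_Icc.2 zero_le_one, hn0⟩ hsub ⟨1, right_mem_Icc.2 zero_le_one, hn1⟩

theorem finrank_span_pair {x y : V d} (h : ∀ a b : ℝ, a • x + b • y = 0 → a = 0 ∧ b = 0) :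
    Module.finrank ℝ (Submodule.span ℝ {x, y}) = 2 := by
  have hli : LinearIndependent ℝ ![x, y] := LinearIndependent.pair_iff.2 h
  have := finrank_span_eq_card hli
  have hr : range ![x, y] = {x, y} := by
    ext z
    simp [eq_comm, or_comm]
  rwa [hr, Fintype.card_fin] at this

/-- With `k = ⟨x, y⟩ < -1`, the Gram determinant `1 - k²` is nonzero, so the span is a plane; `q(x -
y) = -2 - 2k > 0` gives the signature, and `k < 0` puts both points on one branch. -/
theorem spaceRelated_of_form_lt {x y : AdS d} (h : form (x : V d) (y : V d) < -1) :
    SpaceRelated x y := by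
  have hx := AdS.quad_eq x
  have hy := AdS.quad_eq y
  set P := Submodule.span ℝ {(x : V d), (y : V d)} with hP
  have hxP : (x : V d) ∈ P := Submodule.subset_span (by simp)
  have hyP : (y : V d) ∈ P := Submodule.subset_span (by simp)
  refine ⟨connectedComponentIn ((P : Set (V d)) ∩ AdS d) x, ⟨P, finrank_span_pair ?_,
    ⟨(x : V d) - y, P.sub_mem hxP hyP, ?_⟩, ⟨x, hxP, by rw [hx]; norm_num⟩, x, ⟨hxP, x.2⟩, rfl⟩,
    mem_connectedComponentIn ⟨hxP, x.2⟩,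
    mem_connectedComponentIn_of_form_neg P ⟨hxP, x.2⟩ ⟨hyP, y.2⟩ (by linarith)⟩
  · intro a b hab
    have h1 : form (a • (x : V d) + b • (y : V d)) x = 0 := by rw [hab]; simp [form]
    have h2 : form (a • (x : V d) + b • (y : V d)) y = 0 := by rw [hab]; simp [form]
    rw [form_add_left, form_smul_left, form_smul_left] at h1 h2
    rw [form_comm (y : V d) x] at h1
    change form (x : V d) x = -1 at hx
    change form (y : V d) y = -1 at hy
    rw [hx] at h1
    rw [hy] at h2
    set k := form (x : V d) (y : V d)
    have hk : k ^ 2 - 1 ≠ 0 := by nlinarith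
    have ha : a * (k ^ 2 - 1) = 0 := by linear_combination h1 + k * h2
    have hb : b * (k ^ 2 - 1) = 0 := by linear_combination k * h1 + h2
    exact ⟨(mul_eq_zero.1 ha).resolve_right hk, (mul_eq_zero.1 hb).resolve_right hk⟩
  · rw [AdS.quad_sub]; linarith


end

end AdSGeometry

/-! ### The sphere of rays, geodesics and photons through isotropic vectors. -/

namespace AdSGeometry

noncomputable section

variable {d : ℕ}

/-! ### The sphere of rays -/

theorem continuous_rayOfNeZero {X : Type*} [TopologicalSpace X] {φ : X → V d} (hφ : Continuous φ)
    (h0 : ∀ x, φ x ≠ 0) : Continuous fun x => (rayOfNeZero ℝ (φ x) (h0 x) : RaySphere d) := by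
  have h : Continuous fun v : {v : V d // v ≠ 0} => (rayOfNeZero ℝ v.1 v.2 : RaySphere d) :=
    continuous_coinduced_rng
  exact h.comp (hφ.subtype_mk h0)

/-- The unit vector of a ray. -/
def RaySphere.dir (r : RaySphere d) : V d := ‖r.someVector‖⁻¹ • r.someVector

theorem RaySphere.dir_rayOfNeZero (v : V d) (hv : v ≠ 0) :
    RaySphere.dir (rayOfNeZero ℝ v hv) = ‖v‖⁻¹ • v := by
  have h := (ray_eq_iff (Module.Ray.someVector_ne_zero (rayOfNeZero ℝ v hv)) hv).1
    (Module.Ray.someVector_ray _)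
  exact (sameRay_iff_inv_norm_smul_eq_of_ne (Module.Ray.someVector_ne_zero _) hv).1 h

theorem RaySphere.dir_injective : Function.Injective (RaySphere.dir (d := d)) := by
  intro r r' h
  have := (sameRay_iff_inv_norm_smul_eq_of_ne (Module.Ray.someVector_ne_zero r)
    (Module.Ray.someVector_ne_zero r')).2 h
  rw [← Module.Ray.someVector_ray r, ← Module.Ray.someVector_ray r', ray_eq_iff]
  exact this

theorem RaySphere.continuous_dir : Continuous (RaySphere.dir (d := d)) := by
  rw [continuous_coinduced_dom]
  have : (RaySphere.dir ∘ fun v : {v : V d // v ≠ 0} => rayOfNeZero ℝ v.1 v.2) =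
      fun v => ‖v.1‖⁻¹ • v.1 := funext fun v => RaySphere.dir_rayOfNeZero v.1 v.2
  rw [this]
  exact (continuous_subtype_val.norm.inv₀ fun v => norm_ne_zero_iff.2 v.2).smul
    continuous_subtype_val

/-- Needed so that compact arcs of rays are closed and the boundary map is a closed embedding. -/
instance RaySphere.instT2Space : T2Space (RaySphere d) :=
  T2Space.of_injective_continuous RaySphere.dir_injective RaySphere.continuous_dir

/-! ### Pairs of isotropic vectors -/

section IsotropicPair

variable {u v : V d}

theorem linearIndependent_of_form_neg (hu : quad u = 0) (hv : quad v = 0) (huv : form u v < 0)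
    {a b : ℝ} (h : a • u + b • v = 0) : a = 0 ∧ b = 0 := by
  have h1 : form (a • u + b • v) u = 0 := by rw [h]; simp [form]
  have h2 : form (a • u + b • v) v = 0 := by rw [h]; simp [form]
  rw [form_add_left, form_smul_left, form_smul_left] at h1 h2
  change form u u = 0 at hu
  change form v v = 0 at hv
  rw [hu, form_comm v u] at h1
  rw [hv] at h2
  constructor
  · simpa [huv.ne] using h2
  · simpa [huv.ne] using h1

/-- The geodesic spanned by two isotropic vectors with negative product. -/
theorem mem_connectedComponentIn_span_iff (hu : quad u = 0) (hv : quad v = 0)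
    (huv : form u v < 0) {s : ℝ} (hs : 0 < s) (hsk : 2 * s * s * form u v = -1) (y : V d) :
    y ∈ connectedComponentIn ((Submodule.span ℝ {u, v} : Set (V d)) ∩ AdS d) (s • u + s • v) ↔
      ∃ a b : ℝ, 0 < a ∧ 0 < b ∧ 2 * a * b * form u v = -1 ∧ y = a • u + b • v := by
  set P := Submodule.span ℝ {u, v} with hP
  have hmem : ∀ a b : ℝ, a • u + b • v ∈ P := fun a b =>
    Submodule.mem_span_pair.2 ⟨a, b, rfl⟩
  have hquad : ∀ a b : ℝ, quad (a • u + b • v) = 2 * a * b * form u v := fun a b => by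
    rw [quad_smul_add_smul, hu, hv]; ring
  have hform : ∀ a b : ℝ, form (a • u + b • v) v = a * form u v := fun a b => by
    rw [form_add_left, form_smul_left, form_smul_left, show form v v = 0 from hv]; ring
  have hx0 : s • u + s • v ∈ (P : Set (V d)) ∩ AdS d := ⟨hmem s s, (hquad s s).trans hsk⟩
  constructor
  · intro hy
    have hyP := connectedComponentIn_subset _ _ hy
    obtain ⟨a, b, rfl⟩ := Submodule.mem_span_pair.1 hyP.1
    have hab : 2 * a * b * form u v = -1 := (hquad a b).symm.trans hyP.2
    have habpos : 0 < a * b := by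
      by_contra! h
      nlinarith
    -- Otherwise `⟨·, v⟩` would vanish somewhere on the connected component, hence so would the
    -- coefficient of `u`, contradicting `q = -1`.
    have ha : 0 < a := by
      by_contra! ha
      obtain ⟨z, hz, hz0⟩ := (isPreconnected_connectedComponentIn).intermediate_value
        (mem_connectedComponentIn hx0) hy (continuous_form_left v).continuousOn
        (show (0 : ℝ) ∈ _ from ⟨by rw [hform]; nlinarith, by rw [hform]; nlinarith⟩)
      have hzP := connectedComponentIn_subset _ _ hz
      obtain ⟨a', b', rfl⟩ := Submodule.mem_span_pair.1 hzP.1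
      beta_reduce at hz0
      rw [hform] at hz0
      have h1 : 2 * a' * b' * form u v = -1 := (hquad a' b').symm.trans hzP.2
      have h2 : 2 * a' * b' * form u v = 2 * b' * (a' * form u v) := by ring
      rw [h2, hz0] at h1
      norm_num at h1
    exact ⟨a, b, ha, (mul_pos_iff_of_pos_left ha).1 habpos, hab, rfl⟩
  · rintro ⟨a, b, ha, hb, hab, rfl⟩
    refine mem_connectedComponentIn_of_form_neg P hx0 ⟨hmem a b, (hquad a b).trans hab⟩ ?_
    have : form (s • u + s • v) (a • u + b • v) = s * (a + b) * form u v := by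
      simp only [form_add_left, form_add_right, form_smul_left, form_smul_right,
        show form u u = 0 from hu, show form v v = 0 from hv, form_comm v u]
      ring
    rw [this]
    exact mul_neg_of_pos_of_neg (by positivity) huv

/-- Two isotropic vectors with negative product span the endpoints of a spacelike geodesic. -/
theorem exists_isSpacelikeGeodesic (hu0 : u ≠ 0) (hv0 : v ≠ 0) (hu : quad u = 0)
    (hv : quad v = 0) (huv : form u v < 0) :
    ∃ G : Set (V d), IsSpacelikeGeodesic G ∧
      closure (rays G) \ rays G = {rayOfNeZero ℝ u hu0, rayOfNeZero ℝ v hv0} := by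
  -- Chosen so that `s u + s v` lies on the quadric; it is the base point of the branch.
  obtain ⟨s, hs, hsk⟩ : ∃ s : ℝ, 0 < s ∧ 2 * s * s * form u v = -1 := by
    have h : 0 < -(2 * form u v) := by linarith
    refine ⟨(√(-(2 * form u v)))⁻¹, by positivity, ?_⟩
    have h2 : √(-(2 * form u v)) * √(-(2 * form u v)) = -(2 * form u v) :=
      Real.mul_self_sqrt h.le
    have h3 : √(-(2 * form u v)) ≠ 0 := (Real.sqrt_pos.2 h).ne'
    field_simp
    rw [sq, h2]; ring
  have hind := fun a b h => linearIndependent_of_form_neg hu hv huv (a := a) (b := b) h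
  have hG := mem_connectedComponentIn_span_iff hu hv huv hs hsk
  set P := Submodule.span ℝ {u, v} with hP
  have hmem : ∀ a b : ℝ, a • u + b • v ∈ P := fun a b =>
    Submodule.mem_span_pair.2 ⟨a, b, rfl⟩
  have hquad : ∀ a b : ℝ, quad (a • u + b • v) = 2 * a * b * form u v := fun a b => by
    rw [quad_smul_add_smul, hu, hv]; ring
  set G := connectedComponentIn ((P : Set (V d)) ∩ AdS d) (s • u + s • v) with hGdef
  refine ⟨G, ⟨P, finrank_span_pair hind, ⟨_, hmem 1 (-1), by rw [hquad]; linarith⟩,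
    ⟨_, hmem 1 1, by rw [hquad]; linarith⟩, _, ⟨hmem s s, (hquad s s).trans hsk⟩, rfl⟩, ?_⟩
  -- the closed arc of rays between `u` and `v`
  have hne : ∀ t : ℝ, (1 - t) • u + t • v ≠ 0 := fun t h => by
    have := hind _ _ h
    linarith [this.1, this.2]
  set c : ℝ → RaySphere d := fun t => rayOfNeZero ℝ ((1 - t) • u + t • v) (hne t) with hc
  have hcc : Continuous c := continuous_rayOfNeZero (by fun_prop) hne
  have hcinj : Function.Injective c := by
    intro t t' h
    obtain ⟨r, hr, hrt⟩ := ((ray_eq_iff _ _).1 h).exists_pos_left (hne t) (hne t')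
    have h0 : (r * (1 - t) - (1 - t')) • u + (r * t - t') • v = 0 := by
      rw [← sub_eq_zero] at hrt
      rw [← hrt]
      module
    obtain ⟨h1, h2⟩ := hind _ _ h0
    have hr1 : r = 1 := by linarith
    rw [hr1, one_mul] at h2
    exact sub_eq_zero.1 h2
  have hrays : rays G = c '' Ioo 0 1 := by
    ext r
    constructor
    · rintro ⟨y, hy0, hy, rfl⟩
      obtain ⟨a, b, ha, hb, -, rfl⟩ := (hG y).1 hy
      refine ⟨b / (a + b), ⟨by positivity, (div_lt_one (by positivity)).2 (by linarith)⟩, ?_⟩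
      refine (ray_eq_iff _ _).2 ?_
      have : a • u + b • v = (a + b) • ((1 - b / (a + b)) • u + (b / (a + b)) • v) := by
        have : a + b ≠ 0 := by positivity
        rw [smul_add, smul_smul, smul_smul]
        congr 2 <;> field_simp
        ring
      rw [this]
      exact SameRay.sameRay_pos_smul_right _ (by positivity)
    · rintro ⟨t, ht, rfl⟩
      have h1t : 0 < 1 - t := by linarith [ht.2]
      have ht0 : 0 < t := ht.1
      have hk : 0 < -(2 * (1 - t) * t * form u v) := by
        have : 0 < (1 - t) * t := by positivity
        nlinarith
      set l := (√(-(2 * (1 - t) * t * form u v)))⁻¹ with hl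
      have hl0 : 0 < l := by positivity
      have hll : l * l * (2 * (1 - t) * t * form u v) = -1 := by
        have h2 := Real.mul_self_sqrt hk.le
        have h3 : √(-(2 * (1 - t) * t * form u v)) ≠ 0 := (Real.sqrt_pos.2 hk).ne'
        rw [hl, ← mul_inv, h2, inv_mul_eq_div, div_eq_iff hk.ne']
        ring
      refine ⟨l • ((1 - t) • u + t • v), smul_ne_zero hl0.ne' (hne t), ?_, ?_⟩
      · refine (hG _).2 ⟨l * (1 - t), l * t, by positivity, by positivity, ?_, by
          rw [smul_add, smul_smul, smul_smul]⟩
        linear_combination hll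
      · exact (ray_eq_iff _ _).2 (SameRay.sameRay_pos_smul_right _ hl0)
  have hcl : closure (c '' Ioo 0 1) = c '' Icc 0 1 := by
    apply Subset.antisymm
    · exact closure_minimal (image_mono Ioo_subset_Icc_self)
        (isCompact_Icc.image hcc).isClosed
    · rw [← closure_Ioo zero_ne_one]
      exact image_closure_subset_closure_image hcc
  rw [hrays, hcl, ← image_sdiff hcinj, Icc_sdiff_Ioo_same zero_le_one, image_pair]
  congr 1
  · exact (ray_eq_iff _ _).2 (by simp [SameRay.refl])
  · rw [singleton_eq_singleton_iff]
    exact (ray_eq_iff _ _).2 (by simp [SameRay.refl])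

/-- Two linearly independent orthogonal isotropic vectors span a photon. -/
theorem exists_photon (hu0 : u ≠ 0) (hv0 : v ≠ 0) (hu : quad u = 0)
    (hv : quad v = 0) (huv : form u v = 0) (hind : ∀ a b : ℝ, a • u + b • v = 0 → a = 0 ∧ b = 0) :
    ∃ P : Submodule ℝ (V d), Module.finrank ℝ P = 2 ∧ (∀ u ∈ P, ∀ v ∈ P, form u v = 0) ∧
      rayOfNeZero ℝ u hu0 ∈ rays (P : Set (V d)) ∧ rayOfNeZero ℝ v hv0 ∈ rays (P : Set (V d)) := by
  refine ⟨Submodule.span ℝ {u, v}, finrank_span_pair hind, ?_,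
    ⟨u, hu0, Submodule.subset_span (by simp), rfl⟩, ⟨v, hv0, Submodule.subset_span (by simp), rfl⟩⟩
  intro x hx y hy
  obtain ⟨a, b, rfl⟩ := Submodule.mem_span_pair.1 hx
  obtain ⟨a', b', rfl⟩ := Submodule.mem_span_pair.1 hy
  simp only [form_add_left, form_add_right, form_smul_left, form_smul_right,
    show form u u = 0 from hu, show form v v = 0 from hv, form_comm v u, huv]
  ring

end IsotropicPair

end

end AdSGeometry

/-! ### Extension to the closed ball and the boundary in the Einstein space. -/

namespace AdSGeometry

noncomputable section

variable {d : ℕ}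

/-- The height `√(1 - ‖b‖²)` of the point of the unit hemisphere above a point of the unit ball. -/
def hemisphereHeight (b : E d) : ℝ := √(1 - ‖b‖ ^ 2)

theorem hemisphereHeight_of_norm_eq_one {b : E d} (hb : ‖b‖ = 1) : hemisphereHeight b = 0 := by
  simp [hemisphereHeight, hb]

@[fun_prop]
theorem continuous_hemisphereHeight : Continuous (hemisphereHeight (d := d)) := by
  unfold hemisphereHeight; fun_prop

/-- The second factor of a point of `AdS^{d+1}`, normalized. -/
def AdS.direction (x : AdS d) : E 2 := ‖(x : V d).2‖⁻¹ • (x : V d).2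

theorem AdS.norm_direction (x : AdS d) : ‖AdS.direction x‖ = 1 := by
  rw [direction, norm_smul, norm_inv, norm_norm,
    inv_mul_cancel₀ (norm_ne_zero_iff.2 (AdS.snd_ne_zero x))]

theorem AdS.norm_snd (x : AdS d) : ‖(x : V d).2‖ = √(1 + ‖(x : V d).1‖ ^ 2) := by
  rw [← AdS.norm_snd_sq, Real.sqrt_sq (norm_nonneg _)]

/-- `Homeomorph.unitBall` divides by `√(1 + ‖x‖²)`, which on the quadric is the norm of the second
factor. One rescaling thus produces both the point of the ball and the unit direction. -/
theorem coe_unitBall_eq (x : AdS d) :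
    (Homeomorph.unitBall (x : V d).1 : E d) = ‖(x : V d).2‖⁻¹ • (x : V d).1 := by
  rw [Homeomorph.unitBall_apply_coe, OpenPartialHomeomorph.univUnitBall_apply, AdS.norm_snd]

theorem hemisphereHeight_unitBall (x : AdS d) :
    hemisphereHeight (Homeomorph.unitBall (x : V d).1 : E d) = ‖(x : V d).2‖⁻¹ := by
  have h0 : 0 < ‖(x : V d).2‖ := norm_pos_iff.2 (AdS.snd_ne_zero x)
  have h : 1 - ‖‖(x : V d).2‖⁻¹ • (x : V d).1‖ ^ 2 = (‖(x : V d).2‖⁻¹) ^ 2 := by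
    rw [norm_smul, norm_inv, norm_norm, mul_pow, inv_pow]
    field_simp
    rw [AdS.norm_snd_sq]; ring
  rw [hemisphereHeight, coe_unitBall_eq, h, Real.sqrt_sq (by positivity)]

/-- Divide `⟨x, y⟩ < -1` by the norms of the second factors: the left side becomes the inner product
of two points of the unit hemisphere. -/
theorem inner_lt_inner_direction_iff (x y : AdS d) :
    inner ℝ (Homeomorph.unitBall (x : V d).1 : E d) (Homeomorph.unitBall (y : V d).1 : E d) +
      hemisphereHeight (Homeomorph.unitBall (x : V d).1 : E d) *
        hemisphereHeight (Homeomorph.unitBall (y : V d).1 : E d) <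
      inner ℝ (AdS.direction x) (AdS.direction y) ↔ form (x : V d) (y : V d) < -1 := by
  rw [hemisphereHeight_unitBall, hemisphereHeight_unitBall, coe_unitBall_eq, coe_unitBall_eq,
    AdS.direction, AdS.direction, real_inner_smul_left, real_inner_smul_right,
    real_inner_smul_left, real_inner_smul_right, form_eq]
  have hx : 0 < ‖(x : V d).2‖⁻¹ := inv_pos.2 (norm_pos_iff.2 (AdS.snd_ne_zero x))
  have hy : 0 < ‖(y : V d).2‖⁻¹ := inv_pos.2 (norm_pos_iff.2 (AdS.snd_ne_zero y))
  have hxy := mul_pos hx hy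
  rw [← sub_pos, ← sub_pos (b := _ - _)]
  have e : ‖(x : V d).2‖⁻¹ * (‖(y : V d).2‖⁻¹ * inner ℝ (x : V d).2 (y : V d).2) -
      (‖(x : V d).2‖⁻¹ * (‖(y : V d).2‖⁻¹ * inner ℝ (x : V d).1 (y : V d).1) +
        ‖(x : V d).2‖⁻¹ * ‖(y : V d).2‖⁻¹) =
      (‖(x : V d).2‖⁻¹ * ‖(y : V d).2‖⁻¹) *
        (-1 - (inner ℝ (x : V d).1 (y : V d).1 - inner ℝ (x : V d).2 (y : V d).2)) := by ring
  rw [e, mul_pos_iff_of_pos_left hxy]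

/-- A map from the open unit ball to the unit sphere that contracts the distance of the hemisphere
extends to the closed ball. -/
theorem exists_extension_of_inner_le {ζ : ball (0 : E d) 1 → E 2} (hζ : ∀ b, ‖ζ b‖ = 1)
    (hle : ∀ b b' : ball (0 : E d) 1, inner ℝ (b : E d) (b' : E d) +
      hemisphereHeight (b : E d) * hemisphereHeight (b' : E d) ≤ inner ℝ (ζ b) (ζ b')) :
    ∃ Z : E d → E 2, Continuous Z ∧ (∀ b : ball (0 : E d) 1, Z b = ζ b) ∧
      (∀ b ∈ closedBall (0 : E d) 1, ‖Z b‖ = 1) ∧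
      ∀ b ∈ closedBall (0 : E d) 1, ∀ b' ∈ closedBall (0 : E d) 1,
        inner ℝ b b' + hemisphereHeight b * hemisphereHeight b' ≤ inner ℝ (Z b) (Z b') := by
  set w : E d → WithLp 2 (E d × ℝ) := fun b => WithLp.toLp 2 (b, hemisphereHeight b) with hw
  have hwc : Continuous w := by fun_prop
  have hwinner : ∀ b b', inner ℝ (w b) (w b') =
      inner ℝ b b' + hemisphereHeight b * hemisphereHeight b' := fun b b' => by
    simp [hw, WithLp.prod_inner_apply, mul_comm]
  have hwnorm : ∀ b : ball (0 : E d) 1, ‖w b‖ ^ 2 = 1 := fun b => by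
    have hb : ‖(b : E d)‖ < 1 := mem_ball_zero_iff.1 b.2
    rw [← real_inner_self_eq_norm_sq, hwinner, real_inner_self_eq_norm_sq, hemisphereHeight,
      Real.mul_self_sqrt (by nlinarith [norm_nonneg (b : E d)])]
    ring
  classical
  -- Between unit vectors, squared distance is `2 - 2⟨·,·⟩`, so the hypothesis says 1-Lipschitz on
  -- the open hemisphere.
  have hLip : LipschitzOnWith 1 (fun y : WithLp 2 (E d × ℝ) =>
      if h : y.fst ∈ ball (0 : E d) 1 then ζ ⟨y.fst, h⟩ else 0) (w '' ball 0 1) := by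
    refine LipschitzOnWith.of_dist_le_mul ?_
    rintro _ ⟨b, hb, rfl⟩ _ ⟨b', hb', rfl⟩
    have e1 : (w b).fst = b := rfl
    have e2 : (w b').fst = b' := rfl
    rw [NNReal.coe_one, one_mul]
    simp only [e1, e2, hb, hb', dif_pos]
    rw [dist_eq_norm, dist_eq_norm]
    refine abs_le_of_sq_le_sq' ?_ (norm_nonneg _) |>.2
    rw [@norm_sub_sq_real, @norm_sub_sq_real, hζ, hζ, hwnorm ⟨b, hb⟩, hwnorm ⟨b', hb'⟩, hwinner]
    have := hle ⟨b, hb⟩ ⟨b', hb'⟩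
    simp only at this
    linarith
  -- Only continuity of the extension is used; norm and contraction pass to the closed ball by
  -- density.
  obtain ⟨G, hG, hGe⟩ := hLip.extend_finite_dimension
  have hZc : Continuous fun b => G (w b) := hG.continuous.comp hwc
  have hext : ∀ b : ball (0 : E d) 1, G (w b) = ζ b := fun b => by
    rw [← hGe ⟨b, b.2, rfl⟩]
    exact dif_pos b.2
  refine ⟨fun b => G (w b), hZc, hext, ?_, ?_⟩
  · intro b hb
    rw [← closure_ball (0 : E d) one_ne_zero] at hb
    refine closure_minimal (t := {b | ‖G (w b)‖ = 1}) ?_ (isClosed_eq hZc.norm continuous_const) hb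
    intro b hb
    change ‖G (w b)‖ = 1
    rw [hext ⟨b, hb⟩, hζ]
  · intro b hb b' hb'
    have hmem : (b, b') ∈ closure (ball (0 : E d) 1 ×ˢ ball (0 : E d) 1) := by
      rw [closure_prod_eq, closure_ball (0 : E d) one_ne_zero]
      exact ⟨hb, hb'⟩
    refine closure_minimal (t := {a : E d × E d | inner ℝ a.1 a.2 +
      hemisphereHeight a.1 * hemisphereHeight a.2 ≤ inner ℝ (G (w a.1)) (G (w a.2))}) ?_ ?_ hmem
    · rintro ⟨a, a'⟩ ⟨ha, ha'⟩
      change inner ℝ a a' + hemisphereHeight a * hemisphereHeight a' ≤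
        inner ℝ (G (w a)) (G (w a'))
      rw [hext ⟨a, ha⟩, hext ⟨a', ha'⟩]
      exact hle ⟨a, ha⟩ ⟨a', ha'⟩
    · refine isClosed_le ?_ ?_
      · fun_prop
      · exact (hZc.comp continuous_fst).inner (hZc.comp continuous_snd)

/-- A map that strictly contracts inside the hemisphere does not send antipodal points of the
boundary to antipodal points. -/
theorem ne_neg_of_inner_le {Z : E d → E 2} (hZ1 : ∀ b ∈ closedBall (0 : E d) 1, ‖Z b‖ = 1)
    (hle : ∀ b ∈ closedBall (0 : E d) 1, ∀ b' ∈ closedBall (0 : E d) 1,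
        inner ℝ b b' + hemisphereHeight b * hemisphereHeight b' ≤ inner ℝ (Z b) (Z b'))
    (hlt : ∀ b ∈ ball (0 : E d) 1, ∀ b' ∈ ball (0 : E d) 1, b ≠ b' →
        inner ℝ b b' + hemisphereHeight b * hemisphereHeight b' < inner ℝ (Z b) (Z b'))
    {z : E d} (hz : ‖z‖ = 1) : Z (-z) ≠ -Z z := by
  intro hneg
  have hπ := Real.pi_pos
  have h0 : (0 : E d) ∈ closedBall (0 : E d) 1 := mem_closedBall_self zero_le_one
  have hzm : z ∈ closedBall (0 : E d) 1 := by simp [hz]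
  have hzm' : -z ∈ closedBall (0 : E d) 1 := by simp [hz]
  have hcpos : 0 < Real.cos (Real.pi / 4) := by rw [Real.cos_pi_div_four]; positivity
  have hc2 : Real.cos (Real.pi / 4) ^ 2 = 1 / 2 := by
    rw [Real.cos_pi_div_four, div_pow, Real.sq_sqrt (by norm_num)]; norm_num
  -- `c • z` lies under the midpoint of the quarter circle from the pole to `z`. The first half is
  -- contracted strictly, so the angle between `Z 0` and `Z z` is less than `π / 2`; yet `Z (-z) =
  -- -Z z` and contraction from the pole to `-z` make it at least `π / 2`.
  set c := Real.cos (Real.pi / 4) with hc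
  have hmn : ‖c • z‖ = c := by rw [norm_smul, hz, mul_one, Real.norm_of_nonneg hcpos.le]
  have hm : c • z ∈ ball (0 : E d) 1 := by
    rw [mem_ball_zero_iff, hmn]; nlinarith
  have hheight : hemisphereHeight (c • z) = c := by
    rw [hemisphereHeight, hmn, show 1 - c ^ 2 = c ^ 2 by rw [hc2]; norm_num, Real.sqrt_sq hcpos.le]
  have hheight0 : hemisphereHeight (0 : E d) = 1 := by simp [hemisphereHeight]
  have i1 := hlt 0 (mem_ball_self one_pos) (c • z) hm (fun h => by
    rw [← h, norm_zero] at hmn; exact hcpos.ne hmn)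
  rw [inner_zero_left, hheight, hheight0] at i1
  have i2 := hle (c • z) (ball_subset_closedBall hm) z hzm
  rw [real_inner_smul_left, real_inner_self_eq_norm_sq, hz, hemisphereHeight_of_norm_eq_one hz] at i2
  have i3 := hle 0 h0 (-z) hzm'
  rw [inner_zero_left, hemisphereHeight_of_norm_eq_one (b := -z) (by rwa [norm_neg]), hneg,
    inner_neg_right] at i3
  have angle_eq : ∀ a ∈ closedBall (0 : E d) 1, ∀ b ∈ closedBall (0 : E d) 1,
      InnerProductGeometry.angle (Z a) (Z b) = Real.arccos (inner ℝ (Z a) (Z b)) := by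
    intro a ha b hb
    rw [InnerProductGeometry.angle, hZ1 a ha, hZ1 b hb, mul_one, div_one]
  have inner_le : ∀ a ∈ closedBall (0 : E d) 1, ∀ b ∈ closedBall (0 : E d) 1,
      inner ℝ (Z a) (Z b) ≤ 1 := fun a ha b hb => by
    have := real_inner_le_norm (Z a) (Z b)
    rwa [hZ1 a ha, hZ1 b hb, mul_one] at this
  have hac : Real.arccos c = Real.pi / 4 := Real.arccos_cos (by linarith) (by linarith)
  have a1 : InnerProductGeometry.angle (Z 0) (Z (c • z)) < Real.pi / 4 := by
    rw [angle_eq 0 h0 _ (ball_subset_closedBall hm), ← hac]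
    exact Real.arccos_lt_arccos (by linarith) (by linarith)
      (inner_le 0 h0 _ (ball_subset_closedBall hm))
  have a2 : InnerProductGeometry.angle (Z (c • z)) (Z z) ≤ Real.pi / 4 := by
    rw [angle_eq _ (ball_subset_closedBall hm) z hzm, ← hac]
    exact Real.arccos_le_arccos (by linarith)
  have a3 : Real.pi / 2 ≤ InnerProductGeometry.angle (Z 0) (Z z) := by
    rw [angle_eq 0 h0 z hzm]
    by_contra! h
    rw [Real.arccos_lt_pi_div_two] at h
    linarith
  have := InnerProductGeometry.angle_le_angle_add_angle (Z 0) (Z (c • z)) (Z z)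
  linarith

section Boundary

variable {Z : E d → E 2}

/-- The vector `(b, Z b)` of `ℝ^{d,2}`. -/
def graphVec (Z : E d → E 2) (b : E d) : V d := (b, Z b)

theorem graphVec_ne_zero (hZ1 : ∀ b ∈ closedBall (0 : E d) 1, ‖Z b‖ = 1)
    (b : closedBall (0 : E d) 1) : graphVec Z b ≠ 0 := by
  intro h
  have h1 : Z b = 0 := congrArg Prod.snd h
  have := hZ1 b b.2
  rw [h1, norm_zero] at this
  exact zero_ne_one this

/-- The map from the closed ball to the sphere of rays given by the rays of a graph. -/
def graphRay (hZ1 : ∀ b ∈ closedBall (0 : E d) 1, ‖Z b‖ = 1) (b : closedBall (0 : E d) 1) :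
    RaySphere d := rayOfNeZero ℝ (graphVec Z b) (graphVec_ne_zero hZ1 b)

theorem continuous_graphRay (hZ : Continuous Z) (hZ1 : ∀ b ∈ closedBall (0 : E d) 1, ‖Z b‖ = 1) :
    Continuous (graphRay hZ1) :=
  continuous_rayOfNeZero
    (continuous_subtype_val.prodMk (hZ.comp continuous_subtype_val)) _

/-- The second factor has norm 1, which forces the scalar between two representatives to be 1. -/
theorem graphRay_injective (hZ1 : ∀ b ∈ closedBall (0 : E d) 1, ‖Z b‖ = 1) :
    Function.Injective (graphRay hZ1) := by
  intro b b' h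
  obtain ⟨r, hr, hrb⟩ := ((ray_eq_iff _ _).1 h).exists_pos_left (graphVec_ne_zero hZ1 b)
    (graphVec_ne_zero hZ1 b')
  have h1 : r • (b : E d) = b' := congrArg Prod.fst hrb
  have h2 : r • Z b = Z b' := congrArg Prod.snd hrb
  have h3 := congrArg norm h2
  rw [norm_smul, hZ1 b b.2, hZ1 b' b'.2, mul_one, Real.norm_of_nonneg hr.le] at h3
  rw [h3, one_smul] at h1
  exact Subtype.ext h1

theorem quad_graphVec (hZ1 : ∀ b ∈ closedBall (0 : E d) 1, ‖Z b‖ = 1) {b : E d} (hb : ‖b‖ = 1) :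
    quad (graphVec Z b) = 0 := by
  rw [quad_eq, graphVec]
  simp only
  rw [hZ1 b (by simp [hb]), hb]
  ring

theorem graphRay_mem_Ein (hZ1 : ∀ b ∈ closedBall (0 : E d) 1, ‖Z b‖ = 1)
    {b : closedBall (0 : E d) 1} (hb : ‖(b : E d)‖ = 1) : graphRay hZ1 b ∈ Ein d :=
  ⟨graphVec Z b, graphVec_ne_zero hZ1 b, quad_graphVec hZ1 hb, rfl⟩

/-- The boundary map of a graph. -/
def graphBoundary (hZ1 : ∀ b ∈ closedBall (0 : E d) 1, ‖Z b‖ = 1) (z : sphere (0 : E d) 1) :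
    Ein d :=
  ⟨graphRay hZ1 ⟨z, sphere_subset_closedBall z.2⟩,
    graphRay_mem_Ein hZ1 (norm_eq_of_mem_sphere (r := (1 : ℝ)) z)⟩

theorem isEmbedding_graphBoundary (hZ : Continuous Z)
    (hZ1 : ∀ b ∈ closedBall (0 : E d) 1, ‖Z b‖ = 1) : IsEmbedding (graphBoundary hZ1) := by
  have hc : Continuous (graphBoundary hZ1) :=
    ((continuous_graphRay hZ hZ1).comp
      (continuous_subtype_val.subtype_mk fun z => sphere_subset_closedBall z.2)).subtype_mk _
  refine (hc.isClosedEmbedding fun z z' h => ?_).isEmbedding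
  have := graphRay_injective hZ1 (congrArg Subtype.val h)
  exact Subtype.ext (Subtype.mk.inj this)

/-- Heights vanish on the sphere, so contraction makes products of boundary vectors nonpositive.
Since both factors are unit vectors, dependent vectors could only be equal or opposite, and `hneg`
rules out the latter. -/
theorem isAchronal_range_graphBoundary (hZ1 : ∀ b ∈ closedBall (0 : E d) 1, ‖Z b‖ = 1)
    (hle : ∀ b ∈ closedBall (0 : E d) 1, ∀ b' ∈ closedBall (0 : E d) 1,
        inner ℝ b b' + hemisphereHeight b * hemisphereHeight b' ≤ inner ℝ (Z b) (Z b'))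
    (hneg : ∀ z : E d, ‖z‖ = 1 → Z (-z) ≠ -Z z) :
    Ein.IsAchronal (range (graphBoundary hZ1)) := by
  rintro _ ⟨z, rfl⟩ _ ⟨z', rfl⟩ hne
  have hz : ‖(z : E d)‖ = 1 := norm_eq_of_mem_sphere z
  have hz' : ‖(z' : E d)‖ = 1 := norm_eq_of_mem_sphere z'
  have hzm := sphere_subset_closedBall z.2
  have hzm' := sphere_subset_closedBall z'.2
  have hzz : (z : E d) ≠ z' := fun h => hne (congrArg _ (Subtype.ext h))
  have hu := quad_graphVec hZ1 hz
  have hv := quad_graphVec hZ1 hz'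
  have hu0 := graphVec_ne_zero hZ1 ⟨z, hzm⟩
  have hv0 := graphVec_ne_zero hZ1 ⟨z', hzm'⟩
  have hform : form (graphVec Z z) (graphVec Z z') ≤ 0 := by
    have := hle z hzm z' hzm'
    rw [hemisphereHeight_of_norm_eq_one hz, zero_mul, add_zero] at this
    rw [form_eq]
    exact sub_nonpos.2 this
  rcases hform.lt_or_eq with hlt | heq
  · exact Or.inl (exists_isSpacelikeGeodesic hu0 hv0 hu hv hlt)
  · refine Or.inr (exists_photon hu0 hv0 hu hv heq fun a b hab => ?_)
    have h1 : a • (z : E d) + b • (z' : E d) = 0 := congrArg Prod.fst hab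
    have h2 : a • Z z + b • Z z' = 0 := congrArg Prod.snd hab
    have habs : |a| = |b| := by
      have := congrArg norm (eq_neg_of_add_eq_zero_left h1)
      rwa [norm_neg, norm_smul, norm_smul, hz, hz', mul_one, mul_one] at this
    rcases eq_or_ne a 0 with ha | ha
    · rw [ha, abs_zero] at habs
      exact ⟨ha, abs_eq_zero.1 habs.symm⟩
    exfalso
    rcases abs_eq_abs.1 habs with rfl | rfl
    · rw [← smul_add, smul_eq_zero_iff_right ha] at h1 h2
      have e : (z' : E d) = -z := eq_neg_of_add_eq_zero_right h1
      have e2 : Z z' = -Z z := eq_neg_of_add_eq_zero_right h2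
      rw [e] at e2
      exact hneg z hz e2
    · rw [neg_smul, neg_add_eq_zero] at h1
      exact hzz (smul_right_injective _ (neg_ne_zero.1 ha) h1)

end Boundary

end

end AdSGeometry

/-! ### The four conclusions. -/

theorem mainTheorem6 (d : ℕ) (H : Type*) [MetricSpace H] [ConnectedSpace H]
    [ChartedSpace (AdSGeometry.E d) H]
    [HasGroupoid H (AdSGeometry.lipschitzGroupoid d)]
    (hdist : AdSGeometry.IsLipschitzDistance d H)
    (i : H → AdSGeometry.AdS d) (hi : AdSGeometry.IsCompleteSpacelikeImmersion i) :
    Nonempty (H ≃ₜ ball (0 : AdSGeometry.E d) 1) ∧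
    IsEmbedding i ∧
    (∀ x y : H, x ≠ y → AdSGeometry.SpaceRelated (i x) (i y)) ∧
    ∃ (h : H ≃ₜ ball (0 : AdSGeometry.E d) 1)
      (bi : sphere (0 : AdSGeometry.E d) 1 → AdSGeometry.Ein d),
      AdSGeometry.ExtendsContinuouslyTo i h bi ∧ IsEmbedding bi ∧
        AdSGeometry.Ein.IsAchronal (range bi) := by
  let h : H ≃ₜ ball (0 : AdSGeometry.E d) 1 :=
    (hi.isHomeomorph_shadow hdist).homeomorph.trans Homeomorph.unitBall
  have hh : ∀ p, h p = Homeomorph.unitBall (i p : AdSGeometry.V d).1 := fun p => rfl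
  refine ⟨⟨h⟩, hi.isEmbedding hdist,
    fun x y hxy => AdSGeometry.spaceRelated_of_form_lt (hi.form_lt hdist hxy), h, ?_⟩
  have hlt : ∀ b b' : ball (0 : AdSGeometry.E d) 1, b ≠ b' →
      inner ℝ (b : AdSGeometry.E d) (b' : AdSGeometry.E d) +
        AdSGeometry.hemisphereHeight (b : AdSGeometry.E d) *
          AdSGeometry.hemisphereHeight (b' : AdSGeometry.E d) <
      inner ℝ (AdSGeometry.AdS.direction (i (h.symm b)))
        (AdSGeometry.AdS.direction (i (h.symm b'))) := by
    intro b b' hbb'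
    have := (AdSGeometry.inner_lt_inner_direction_iff _ _).2
      (hi.form_lt hdist (h.symm.injective.ne hbb'))
    rwa [← hh, ← hh, h.apply_symm_apply, h.apply_symm_apply] at this
  obtain ⟨Z, hZ, hZe, hZ1, hle⟩ := AdSGeometry.exists_extension_of_inner_le
    (ζ := fun b => AdSGeometry.AdS.direction (i (h.symm b)))
    (fun b => AdSGeometry.AdS.norm_direction _) (fun b b' => by
      -- On the diagonal both sides equal 1.
      rcases eq_or_ne b b' with rfl | hbb'
      · have hb : ‖(b : AdSGeometry.E d)‖ < 1 := mem_ball_zero_iff.1 b.2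
        rw [real_inner_self_eq_norm_sq, real_inner_self_eq_norm_sq,
          AdSGeometry.AdS.norm_direction, AdSGeometry.hemisphereHeight,
          Real.mul_self_sqrt (by nlinarith [norm_nonneg (b : AdSGeometry.E d)])]
        linarith
      · exact (hlt b b' hbb').le)
  have hneg : ∀ z : AdSGeometry.E d, ‖z‖ = 1 → Z (-z) ≠ -Z z := fun z hz =>
    AdSGeometry.ne_neg_of_inner_le hZ1 hle (fun b hb b' hb' hbb' => by
      have := hlt ⟨b, hb⟩ ⟨b', hb'⟩ (fun h => hbb' (congrArg Subtype.val h))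
      rwa [← hZe, ← hZe] at this) hz
  refine ⟨AdSGeometry.graphBoundary hZ1, ⟨AdSGeometry.graphRay hZ1,
    AdSGeometry.continuous_graphRay hZ hZ1, fun p => ?_, fun z => rfl⟩,
    AdSGeometry.isEmbedding_graphBoundary hZ hZ1,
    AdSGeometry.isAchronal_range_graphBoundary hZ1 hle hneg⟩
  refine (ray_eq_iff _ _).2 ?_
  -- The graph vector over `h p` is a positive multiple of `i p`, so they span the same ray.
  have hv : AdSGeometry.graphVec Z (h p) =
      ‖(i p : AdSGeometry.V d).2‖⁻¹ • (i p : AdSGeometry.V d) := by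
    refine Prod.ext ?_ ?_
    · exact AdSGeometry.coe_unitBall_eq (i p)
    · change Z (h p) = _
      rw [hZe, h.symm_apply_apply]
      rfl
  change SameRay ℝ (AdSGeometry.graphVec Z (h p)) _
  rw [hv]
  exact SameRay.sameRay_pos_smul_left _
    (inv_pos.2 (norm_pos_iff.2 (AdSGeometry.AdS.snd_ne_zero (i p))))
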